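/- Let $K$ be a global field (a number field or a finite extension of $\mathbb{F}_p(t)$ for a prime $p$), let $\overline K$ be an algebraic closure of $K$, and let $S$ be a non-empty finite set of endomorphisms of $\mathbb{P}^1$ defined over $K$, all of degree at least $2$. Let $\Phi_S=\prod_{i\ge 1}S$ be the set of infinite sequences in $S$. For $\psi=(\theta_n)_{n\ge1}\in\Phi_S$ and $\alpha\in\mathbb{P}^1(\overline K)$ put $$\psi_n\cdot\alpha=(\theta_n\circ\cdots\circ\theta_1)(\alpha),\qquad \deg(\psi_n)=\prod_{i=1}^n\deg(\theta_i),\qquad \hat h_\psi(\alpha)=\lim_{n\to\infty}\frac{h(\psi_n\cdot\alpha)}{\deg(\psi_n)},$$ where $h$ is the absolute logarithmic Weil height on $\mathbb{P}^1(\overline K)$. (If $K$ is a number field, this is the usual one. If $K$ is a function field, then $h(\infty)=0$ and $h(x)=\frac{1}{[K(x):K]}\sum_w\max\{-w(x),0\}\log\#k_w$ for $x\in\overline K$, where $w$ runs over the normalized discrete valuations of $K(x)$ and $k_w$ is the residue field of $w$.) Let $$\mathrm{PrePer}(\Phi_S)=\{Q\in\mathbb{P}^1(\overline K):\hat h_\psi(Q)=0\text{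 for some }\psi\in\Phi_S\}.$$ Then the limit defining $\hat h_\psi(\alpha)$ exists for all $\psi\in\Phi_S$ and $\alpha\in\mathbb{P}^1(\overline K)$, and for every integer $D>0$ the quantity $$\hat h^{\min}_{\Phi_S,K}(D)=\inf\{\hat h_\psi(\alpha):\ [K(\alpha):K]\le D,\ \alpha\notin\mathrm{PrePer}(\Phi_S),\ \psi\in\Phi_S\}$$ is a strictly positive real number; in particular the set is non-empty. -/

import Mathlib

/-- A global field: a number field, or a finite extension of the rational function field
`𝔽_p(t)` for some prime `p`. -/
def IsGlobalField (K : Type*) [Field K] : Prop :=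
  NumberField K ∨
    ∃ (p : ℕ) (_ : Fact p.Prime) (_ : Algebra (RatFunc (ZMod p)) K), FunctionField (ZMod p) K

/-! ### Weil heights -/

/-- The places of a global function field `L`: the discrete valuation rings with fraction field `L`
and finite residue field. -/
def FunctionFieldPlace (L : Type*) [Field L] : Type _ :=
  {A : ValuationSubring L // IsDiscreteValuationRing A ∧ Finite (IsLocalRing.ResidueField A)}

namespace FunctionFieldPlace

variable {L : Type*} [Field L]

/-- The cardinality of the residue field `k_v` of a place `v`. -/
noncomputable def residueCard (v : FunctionFieldPlace L) : ℕ :=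
  Nat.card (IsLocalRing.ResidueField v.1)

lemma one_lt_residueCard (v : FunctionFieldPlace L) : 1 < (v.residueCard : NNReal) := by
  have := v.2.2
  exact_mod_cast (Finite.one_lt_card : 1 < Nat.card (IsLocalRing.ResidueField v.1))

/-- The normalized absolute value `|x|_v = (#k_v) ^ (-v(x))` of a place `v`. -/
noncomputable def abv (v : FunctionFieldPlace L) : AbsoluteValue L ℝ :=
  haveI := v.2.1
  (IsDiscreteValuationRing.maximalIdeal v.1).adicAbv (K := L) v.one_lt_residueCard

end FunctionFieldPlace

open Classical IntermediateField in
/-- The absolute logarithmic Weil height of an element `x` of an algebraic closure of a global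
field `K`. If `K` is a number field, this is Mathlib's absolute height of the algebraic
number `x`. If `K` is a function field, it is
`[K(x) : K]⁻¹ * ∑_w max (-w(x)) 0 * log #k_w`, the sum being over all places `w` of `K(x)`. -/
noncomputable def affineWeilHeight (K : Type*) [Field K] (x : AlgebraicClosure K) : ℝ :=
  if _h : CharZero K then NumberField.absLogHeight₁ x
  else (∑ᶠ w : FunctionFieldPlace K⟮x⟯, Real.posLog (w.abv (AdjoinSimple.gen K x))) /
    Module.finrank K K⟮x⟯

/-- The geometric points `ℙ¹(K̄)` of the projective line over `K`. -/
abbrev P1 (K : Type*) [Field K] : Type _ :=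
  Projectivization (AlgebraicClosure K) (Fin 2 → AlgebraicClosure K)

namespace P1

variable {K : Type*} [Field K]

/-- The affine coordinate `x / y` of the point `[x : y]`. The point `∞ = [1 : 0]` gets the
coordinate `0`; this is harmless below, since `∞` and `0` have the same height (zero) and the same
field of definition (`K`). -/
noncomputable def coord (P : P1 K) : AlgebraicClosure K := P.rep 0 / P.rep 1

lemma coord_mk (v : Fin 2 → AlgebraicClosure K) (hv : v ≠ 0) :
    coord (Projectivization.mk (AlgebraicClosure K) v hv : P1 K) = v 0 / v 1 := by
  obtain ⟨a, ha⟩ := Projectivization.exists_smul_eq_mk_rep (AlgebraicClosure K) v hv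
  rw [coord, ← ha]
  simp only [Pi.smul_apply, Units.smul_def, smul_eq_mul]
  exact mul_div_mul_left _ _ a.ne_zero

/-- The degree `[K(P) : K]` of the field of definition of `P` over `K`. -/
noncomputable def degree (P : P1 K) : ℕ :=
  Module.finrank K (IntermediateField.adjoin K {P.coord})

/-- The absolute logarithmic Weil height on `ℙ¹(K̄)`. -/
noncomputable def weilHeight (P : P1 K) : ℝ := affineWeilHeight K P.coord

end P1

/-! ### Endomorphisms of the projective line -/

/-- An endomorphism of `ℙ¹` of degree `deg` defined over `K`, presented by two homogeneous
polynomials over `K` of degree `deg` without a common zero in `ℙ¹(K̄)`. -/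
structure P1Endo (K : Type*) [Field K] where
  deg : ℕ
  poly : Fin 2 → MvPolynomial (Fin 2) K
  isHomogeneous : ∀ i, (poly i).IsHomogeneous deg
  no_common_zero : ∀ x : Fin 2 → AlgebraicClosure K, x ≠ 0 →
    (fun i ↦ MvPolynomial.aeval x (poly i)) ≠ 0

namespace P1Endo

variable {K : Type*} [Field K]

/-- The self-map `[x : y] ↦ [F(x, y) : G(x, y)]` of `ℙ¹(K̄)` given by an endomorphism. -/
noncomputable def toFun (φ : P1Endo K) (P : P1 K) : P1 K :=
  Projectivization.mk (AlgebraicClosure K) (fun i ↦ MvPolynomial.aeval P.rep (φ.poly i))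
    (φ.no_common_zero P.rep P.rep_nonzero)

lemma toFun_mk (φ : P1Endo K) (v : Fin 2 → AlgebraicClosure K) (hv : v ≠ 0) :
    φ.toFun (Projectivization.mk (AlgebraicClosure K) v hv) =
      Projectivization.mk (AlgebraicClosure K) (fun i ↦ MvPolynomial.aeval v (φ.poly i))
        (φ.no_common_zero v hv) := by
  obtain ⟨a, ha⟩ := Projectivization.exists_smul_eq_mk_rep (AlgebraicClosure K) v hv
  rw [toFun, Projectivization.mk_eq_mk_iff']
  refine ⟨(a : AlgebraicClosure K) ^ φ.deg, ?_⟩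
  funext i
  rw [← ha]
  simp only [Pi.smul_apply, smul_eq_mul, Units.smul_def, MvPolynomial.aeval_def,
    MvPolynomial.eval₂_eq', Fin.prod_univ_two, Finset.mul_sum]
  refine Finset.sum_congr rfl fun d hd ↦ ?_
  have hd' : d 0 + d 1 = φ.deg := by
    have h := φ.isHomogeneous i (MvPolynomial.mem_support_iff.mp hd)
    rw [← h]
    simp [Finsupp.weight_apply, Finsupp.sum_fintype]
  rw [← hd', pow_add]
  ring

end P1Endo

/-! ### Orbits and canonical heights of sequences of endomorphisms -/

section Sequences

variable {K : Type*} [Field K] {S : Set (P1Endo K)}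

/-- The action `γ_n · P = (θ_n ∘ ⋯ ∘ θ_1)(P)` of the first `n` terms of the infinite sequence
`γ = (θ_1, θ_2, …)` of elements of `S`; here `θ_(n+1)` is `γ n`. -/
noncomputable def seqAct (γ : ℕ → S) : ℕ → P1 K → P1 K
  | 0, P => P
  | n + 1, P => (γ n).1.toFun (seqAct γ n P)

/-- The degree `deg γ_n = deg θ_1 ⋯ deg θ_n`. -/
def seqDeg (γ : ℕ → S) (n : ℕ) : ℕ := ∏ i ∈ Finset.range n, (γ i).1.deg

/-- The canonical height `ĥ_γ(P) = lim_n h(γ_n · P) / deg γ_n`. -/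
noncomputable def canonicalHeight (γ : ℕ → S) (P : P1 K) : ℝ :=
  Filter.limUnder Filter.atTop fun n ↦ (seqAct γ n P).weilHeight / (seqDeg γ n : ℝ)

variable (S) in
/-- The set `PrePer(Φ_S)` of the points `Q` with `ĥ_ψ(Q) = 0` for some sequence `ψ` in `S`. -/
def prePer : Set (P1 K) := {Q | ∃ ψ : ℕ → S, canonicalHeight ψ Q = 0}

end Sequences

/-!
The heart of the matter is that the height `h` satisfies two properties over a global field `K`:
an endomorphism `φ` of `ℙ¹` of degree `d` changes it by `h (φ P) = d * h P + O(1)`, and there are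
only finitely many points of bounded degree and height (Northcott).

Given these, telescoping shows that the limits `ĥ_ψ` exist, that `h (ψ_n P) / deg ψ_n` converges
to `ĥ_ψ P` uniformly in `ψ` and `P`, and in particular that `h P - C ≤ ĥ_ψ P` for a constant `C`
depending only on `S`. As the convergence is uniform, `ψ ↦ ĥ_ψ P` is continuous on the compact
space of sequences in the finite set `S`, so it attains its minimum, which is positive
if `P ∉ PrePer`. The points of degree at most `D` and height at most `C + 1` are finite in number,
hence their canonical heights outside `PrePer` are bounded below; the other points of degree at
most `D` have canonical height at least `1`. Since `K` is infinite and all points with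
`ĥ_ψ P = 0` have height at most `C`, some `K`-rational point lies outside `PrePer`. This part is
`canonicalHeight_lower_bound_of_northcott`.

The estimate for `h (φ P)` is formal once the elements of any finite set lie in a field with a
product formula whose height is a multiple of `h` (`IsAbsoluteWeilHeight`): the upper bound writes
the two forms as linear combinations of monomials, the lower bound uses the projective
Nullstellensatz to write powers of the coordinates as combinations of the forms.

For number fields, Mathlib has the product formula; what is added is the behaviour of the
height in extensions and Northcott's theorem. For a function field `L` over a finite field `F`,
the height is computed by the identity `∏ max(|x|_v, 1) = #F ^ [L : F(x)]` for transcendental `x`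
(`finprod_max_abv_one_of_transcendental`). The inequality `≤` follows from weak approximation and
the fact that elements of `L` regular at some places which are independent over `F` modulo `x⁻¹`
are independent over `F(x)` (`prod_abv_le`). The inequality `≥` follows by counting the functions
`∑ P_j(x) u_j` of bounded degree, for a basis `u_j` of `L` over `F(x)`, and comparing with the
number of principal parts that their poles allow (`card_pow_le_of_linearIndependent`). As
`F(x) = F(x⁻¹)`, the identity contains the product formula. As degrees are multiplicative, it also
shows that the height is multiplied by the degree in a finite extension. The same count shows that
two functions satisfy a polynomial relation of bounded degree (`exists_relation_of_finprod_le`);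
there are finitely many such relations between a fixed `t` and an unknown `x` of bounded height,
which is Northcott's theorem.
-/

/-! ### Homogeneous forms -/

namespace MvPolynomial

variable {σ R : Type*} [CommRing R]

lemma exists_prod_X_eq_monomial {d : ℕ} (s : σ →₀ ℕ) (hs : s.degree = d) :
    ∃ w : Fin d → σ, ∏ a, (X (w a) : MvPolynomial σ R) = monomial s 1 := by
  classical
  have hcard : s.toMultiset.card = d := by
    rw [Finsupp.card_toMultiset, ← hs]; rfl
  obtain ⟨l, hl⟩ := Quot.exists_rep s.toMultiset
  change (l : Multiset σ) = _ at hl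
  have hlen : l.length = d := by rw [← hcard, ← hl]; rfl
  subst hlen
  refine ⟨l.get, ?_⟩
  have h1 : ∏ a, (X (l.get a) : MvPolynomial σ R) = (l.map X).prod := by
    rw [← List.prod_ofFn]
    congr 1
    conv_rhs => rw [← List.ofFn_get l, List.map_ofFn]
    rfl
  rw [h1, ← Multiset.prod_coe, ← Multiset.map_coe, hl, Finsupp.toMultiset_map,
    Finsupp.prod_toMultiset, Finsupp.prod_mapDomain_index (by simp) (by intros; rw [pow_add]),
    monomial_eq, C_1, one_mul]

/-- A homogeneous form of degree `d` is a linear combination of the products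
`X (I 0) * ⋯ * X (I (d - 1))`, over all words `I` of length `d` in the variables. -/
lemma IsHomogeneous.exists_eq_sum_words [Fintype σ] [DecidableEq σ] {d : ℕ} {p : MvPolynomial σ R}
    (hp : p.IsHomogeneous d) :
    ∃ a : (Fin d → σ) → R, p = ∑ I : Fin d → σ, C (a I) * ∏ k, X (I k) := by
  classical
  have key (s : p.support) : (s : σ →₀ ℕ).degree = d := by
    rw [Finsupp.degree_eq_weight_one]; exact hp (mem_support_iff.mp s.2)
  choose w hw using fun s : p.support ↦ exists_prod_X_eq_monomial (R := R) s.1 (key s)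
  refine ⟨fun I ↦ ∑ s : p.support, if w s = I then p.coeff s else 0, ?_⟩
  simp only [map_sum, Finset.sum_mul]
  rw [Finset.sum_comm]
  conv_lhs => rw [← support_sum_monomial_coeff p, ← Finset.sum_coe_sort p.support]
  refine Finset.sum_congr rfl fun s _ ↦ ?_
  rw [Finset.sum_eq_single (w s) (fun I _ hI ↦ by simp [hI.symm]) (by simp)]
  simp [hw s, C_mul_monomial]

lemma homogeneousComponent_mul_of_isHomogeneous {d N : ℕ} {p : MvPolynomial σ R}
    (hp : p.IsHomogeneous d) (r : MvPolynomial σ R) (hN : d ≤ N) :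
    homogeneousComponent N (r * p) = homogeneousComponent (N - d) r * p := by
  classical
  conv_lhs => rw [← sum_homogeneousComponent r, Finset.sum_mul, map_sum]
  have h (i : ℕ) : homogeneousComponent N (homogeneousComponent i r * p) =
      if i = N - d then homogeneousComponent i r * p else 0 := by
    rw [homogeneousComponent_of_mem (m := N) (n := i + d)
      ((homogeneousComponent_isHomogeneous i r).mul hp)]
    congr 1
    simp only [eq_iff_iff]; lia
  simp only [h]
  rw [Finset.sum_ite_eq' ]
  split_ifs with hh
  · rfl
  · rw [homogeneousComponent_eq_zero, zero_mul]
    have : ¬ N - d < r.totalDegree + 1 := by simpa using hh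
    lia

/-- The projective Nullstellensatz: if finitely many forms of degree `d` over `k` have only the
trivial common zero over an algebraically closed extension, then high powers of the variables are
combinations of them with homogeneous coefficients over `k`. -/
lemma exists_sum_mul_eq_X_pow {k A : Type*} [Field k] [Field A] [Algebra k A] [IsAlgClosed A]
    {σ ι : Type*} [Finite σ] [Fintype ι] {d : ℕ} {p : ι → MvPolynomial σ k}
    (hp : ∀ i, (p i).IsHomogeneous d)
    (h0 : ∀ x : σ → A, x ≠ 0 → (fun i ↦ MvPolynomial.aeval x (p i)) ≠ 0) :
    ∃ (M : ℕ) (q : σ → ι → MvPolynomial σ k), (∀ s i, (q s i).IsHomogeneous M) ∧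
      ∀ s, ∑ i, q s i * p i = X s ^ (M + d) := by
  classical
  have := Fintype.ofFinite σ
  set I : Ideal (MvPolynomial σ k) := Ideal.span (Set.range p) with hI
  have hX (s : σ) : X s ∈ I.radical := by
    rw [← vanishingIdeal_zeroLocus_eq_radical (K := A), mem_vanishingIdeal_iff]
    intro x hx
    rw [hI, zeroLocus_span] at hx
    have hx0 : x = 0 := by
      by_contra hne
      refine h0 x hne ?_
      ext i
      exact hx (p i) ⟨i, rfl⟩
    simp [hx0]
  choose m hm using hX
  set N := ∑ s, m s with hN
  have hX' (s : σ) : ∃ r : ι → MvPolynomial σ k, ∑ i, r i * p i = X s ^ (N + d) := by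
    have : X s ^ (N + d) ∈ I :=
      Ideal.pow_mem_of_pow_mem _ (hm s)
        ((Finset.single_le_sum (f := m) (fun _ _ ↦ Nat.zero_le _) (Finset.mem_univ s)).trans
          (Nat.le_add_right _ _))
    rw [hI, Ideal.span, Submodule.mem_span_range_iff_exists_fun] at this
    simpa using this
  choose r hr using hX'
  refine ⟨N, fun s i ↦ homogeneousComponent N (r s i),
    fun s i ↦ homogeneousComponent_isHomogeneous _ _, fun s ↦ ?_⟩
  have h := congrArg (homogeneousComponent (N + d)) (hr s)
  rw [map_sum, homogeneousComponent_eq_self (isHomogeneous_X_pow s _)] at h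
  rw [← h]
  refine Finset.sum_congr rfl fun i _ ↦ ?_
  rw [homogeneousComponent_mul_of_isHomogeneous (hp i) _ (Nat.le_add_left _ _), Nat.add_sub_cancel]

end MvPolynomial

/-! ### Functoriality of heights on the projective line -/

namespace Height

variable {L : Type*} [Field L] [AdmissibleAbsValues L]

lemma logHeight_le_sum_logHeight₁ {ι : Type*} [Fintype ι] (a : ι → L) :
    logHeight a ≤ ∑ i, logHeight₁ (a i) := by
  classical
  have h1 : logHeight (fun I : (i : ι) → Fin 2 ↦ ∏ i, (![a i, 1] : Fin 2 → L) (I i)) =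
      ∑ i, logHeight₁ (a i) := by
    rw [logHeight_fun_prod_eq (x := fun i ↦ (![a i, 1] : Fin 2 → L)) (fun i ↦ by simp)]
    simp [logHeight₁_eq_logHeight]
  rw [← h1]
  convert! logHeight_comp_le (fun i j ↦ if j = i then (0 : Fin 2) else 1)
    (fun I : (i : ι) → Fin 2 ↦ ∏ i, (![a i, 1] : Fin 2 → L) (I i)) using 2
  ext i
  simp only [Function.comp_apply]
  rw [Finset.prod_eq_single i (fun j _ hj ↦ by simp [hj]) (by simp)]
  simp

lemma logHeight_sum_mul_le {ι ι' : Type*} [Fintype ι] [Fintype ι'] (A : ι' → ι → L) (x : ι → L) :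
    logHeight (fun j ↦ ∑ i, A j i * x i) ≤
      totalWeight L * Real.log (Nat.card ι) + ∑ j, ∑ i, logHeight₁ (A j i) + logHeight x := by
  have h := logHeight_linearMap_apply_le (fun ji : ι' × ι ↦ A ji.1 ji.2) x
  have h2 := logHeight_le_sum_logHeight₁ (fun ji : ι' × ι ↦ A ji.1 ji.2)
  rw [Fintype.sum_prod_type] at h2
  linarith

lemma logHeight_words {σ : Type*} [Finite σ] (d : ℕ) {x : σ → L} (hx : x ≠ 0) :
    logHeight (fun I : Fin d → σ ↦ ∏ k, x (I k)) = d * logHeight x := by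
  rw [logHeight_fun_prod_eq (x := fun _ : Fin d ↦ x) (fun _ ↦ hx)]
  simp

end Height

/-- A function `h` on the algebraic closure of `K` is an absolute Weil height if every finite set
of algebraic elements lies in a subfield carrying a family of absolute values with a product
formula, whose (relative) height is a positive multiple `n * h`, and the number of archimedean
absolute values of which is `O(n)`. -/
structure IsAbsoluteWeilHeight {K : Type*} [Field K] (h : AlgebraicClosure K → ℝ) : Prop where
  exists_field : ∃ c : ℝ, ∀ T : Set (AlgebraicClosure K), T.Finite →
    ∃ (L : IntermediateField K (AlgebraicClosure K)) (_ : Height.AdmissibleAbsValues L) (n : ℝ),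
      0 < n ∧ T ⊆ L ∧ Height.totalWeight L ≤ c * n ∧ ∀ x : L, Height.logHeight₁ x = n * h x

namespace IsAbsoluteWeilHeight

open Height

variable {K : Type*} [Field K] {h : AlgebraicClosure K → ℝ}

lemma nonneg (hh : IsAbsoluteWeilHeight h) (x : AlgebraicClosure K) : 0 ≤ h x := by
  obtain ⟨c, hc⟩ := hh.exists_field
  obtain ⟨L, _, n, hn, hT, -, hL⟩ := hc {x} (Set.finite_singleton x)
  have h1 := hL ⟨x, hT rfl⟩
  have h2 := zero_le_logHeight₁ (⟨x, hT rfl⟩ : L)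
  rw [h1] at h2
  exact nonneg_of_mul_nonneg_right h2 hn

/-- An endomorphism of degree `d` multiplies the height by `d` up to a bounded error. The upper
bound comes from writing the two forms as linear combinations of words in the coordinates, the
lower bound from the projective Nullstellensatz. -/
theorem exists_abs_sub_le (hh : IsAbsoluteWeilHeight h) (φ : P1Endo K) :
    ∃ C, ∀ P : P1 K, |h (φ.toFun P).coord - φ.deg * h P.coord| ≤ C := by
  classical
  obtain ⟨c, hc⟩ := hh.exists_field
  choose a ha using fun i ↦ (φ.isHomogeneous i).exists_eq_sum_words
  obtain ⟨M, q, hq, hqX⟩ := MvPolynomial.exists_sum_mul_eq_X_pow φ.isHomogeneous φ.no_common_zero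
  choose b hb using fun s i ↦ (hq s i).exists_eq_sum_words
  set κ : K →+* AlgebraicClosure K := algebraMap K (AlgebraicClosure K)
  set C₁ := c * Real.log (Nat.card (Fin φ.deg → Fin 2)) + ∑ j, ∑ I, h (κ (a j I)) with hC₁
  set C₂ := c * Real.log (Nat.card (Fin 2 × (Fin M → Fin 2))) +
    ∑ s, ∑ jI : Fin 2 × (Fin M → Fin 2), h (κ (b s jI.1 jI.2)) with hC₂
  refine ⟨max C₁ C₂, fun P ↦ ?_⟩
  obtain ⟨L, _, n, hn, hT, hw, hL⟩ := hc {P.rep 0, P.rep 1} (by simp)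
  let x : Fin 2 → L := ![⟨P.rep 0, hT (by simp)⟩, ⟨P.rep 1, hT (by simp)⟩]
  have hx (i : Fin 2) : algebraMap L (AlgebraicClosure K) (x i) = P.rep i := by
    fin_cases i <;> rfl
  have hx0 : x ≠ 0 := by
    intro h0
    apply P.rep_nonzero
    ext i
    rw [← hx i, h0]; simp
  let w : Fin 2 → L := fun j ↦ MvPolynomial.aeval x (φ.poly j)
  have hwA (j : Fin 2) : algebraMap L (AlgebraicClosure K) (w j) =
      MvPolynomial.aeval P.rep (φ.poly j) := by
    rw [← MvPolynomial.aeval_algebraMap_apply]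
    congr 2; ext i; exact hx i
  have hw0 : w ≠ 0 := by
    intro h0
    apply φ.no_common_zero P.rep P.rep_nonzero
    ext j
    rw [← hwA j, h0]; simp
  have hcoef (y : K) : logHeight₁ (algebraMap K L y) = n * h (κ y) := hL _
  have hP : logHeight x = n * h P.coord := by
    have h1 := hL (x 0 / x 1)
    rw [logHeight₁_div_eq_logHeight] at h1
    exact h1
  have hφP : logHeight w = n * h (φ.toFun P).coord := by
    have h1 := hL (w 0 / w 1)
    rw [logHeight₁_div_eq_logHeight] at h1
    rw [P1Endo.toFun, P1.coord_mk]
    have h2 : ((w 0 / w 1 : L) : AlgebraicClosure K) = MvPolynomial.aeval P.rep (φ.poly 0) /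
        MvPolynomial.aeval P.rep (φ.poly 1) := by
      rw [← hwA, ← hwA]; rfl
    rw [h2] at h1
    rw [← h1]; congr 1; ext j; fin_cases j <;> rfl
  have hlog (m : ℕ) : 0 ≤ Real.log m := Real.log_natCast_nonneg m
  -- Upper bound: the coordinates `w` of the image are linear combinations of the words in `x`.
  have up : logHeight w ≤ n * C₁ + φ.deg * logHeight x := by
    have h1 := logHeight_sum_mul_le (fun (j : Fin 2) I ↦ algebraMap K L (a j I))
      (fun I : Fin φ.deg → Fin 2 ↦ ∏ k, x (I k))
    rw [logHeight_words _ hx0] at h1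
    have h2 : w = fun j ↦ ∑ I : Fin φ.deg → Fin 2, algebraMap K L (a j I) * ∏ k, x (I k) :=
      funext fun j ↦ by
        have := congrArg (MvPolynomial.aeval x) (ha j)
        simpa using this
    rw [h2]
    refine h1.trans (add_le_add_left ?_ _)
    simp only [hcoef, ← Finset.mul_sum]
    rw [hC₁, mul_add, ← mul_assoc]
    gcongr ?_ * _ + _
    linarith
  -- Lower bound: the powers `x ^ (M + d)` are linear combinations of the products of `w` with
  -- words of length `M` in `x`.
  have low : (M + φ.deg) * logHeight x ≤ n * C₂ + (logHeight w + M * logHeight x) := by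
    have h1 := logHeight_sum_mul_le
      (fun (s : Fin 2) (jI : Fin 2 × (Fin M → Fin 2)) ↦ algebraMap K L (b s jI.1 jI.2))
      (fun jI : Fin 2 × (Fin M → Fin 2) ↦ w jI.1 * ∏ k, x (jI.2 k))
    have h3 : (fun I : Fin M → Fin 2 ↦ ∏ k, x (I k)) ≠ 0 := by
      obtain ⟨i, hi⟩ := Function.ne_iff.mp hx0
      exact Function.ne_iff.mpr ⟨fun _ ↦ i, Finset.prod_ne_zero_iff.mpr fun _ _ ↦ hi⟩
    rw [logHeight_fun_mul_eq hw0 h3, logHeight_words _ hx0] at h1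
    have h2 : x ^ (M + φ.deg) = fun s ↦ ∑ jI : Fin 2 × (Fin M → Fin 2),
        algebraMap K L (b s jI.1 jI.2) * (w jI.1 * ∏ k, x (jI.2 k)) := by
      ext1 s
      have := congrArg (MvPolynomial.aeval x) (hqX s)
      simp only [map_sum, map_mul, map_pow, MvPolynomial.aeval_X] at this
      rw [Pi.pow_apply, ← this, Fintype.sum_prod_type]
      refine Finset.sum_congr rfl fun j _ ↦ ?_
      rw [congrArg (MvPolynomial.aeval x) (hb s j), map_sum, Finset.sum_mul]
      exact Finset.sum_congr rfl fun I _ ↦ by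
        simp only [w, map_mul, map_prod, MvPolynomial.aeval_X, MvPolynomial.aeval_C]; ring
    rw [← h2, logHeight_pow] at h1
    push_cast at h1
    refine h1.trans (add_le_add_left ?_ _)
    simp only [hcoef, ← Finset.mul_sum]
    rw [hC₂, mul_add, ← mul_assoc]
    gcongr ?_ * _ + _
    linarith
  rw [hP, hφP] at up low
  have up' : n * (h (φ.toFun P).coord - φ.deg * h P.coord) ≤ n * C₁ := by linarith
  have low' : n * -(h (φ.toFun P).coord - φ.deg * h P.coord) ≤ n * C₂ := by linarith
  rw [abs_le]
  have := le_of_mul_le_mul_left up' hn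
  have := le_of_mul_le_mul_left low' hn
  constructor
  · linarith [le_max_right C₁ C₂]
  · linarith [le_max_left C₁ C₂]

end IsAbsoluteWeilHeight

/-! ### Canonical heights of sequences of endomorphisms -/

section CanonicalHeights

open Filter Topology

variable {K : Type*} [Field K] {S : Set (P1Endo K)}

lemma two_pow_le_seqDeg (hdeg : ∀ φ ∈ S, 2 ≤ φ.deg) (ψ : ℕ → S) (n : ℕ) :
    (2 : ℝ) ^ n ≤ seqDeg ψ n := by
  have : 2 ^ n ≤ seqDeg ψ n := by
    simpa [seqDeg] using
      Finset.prod_le_prod' (s := Finset.range n) fun i _ ↦ hdeg _ (ψ i).2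
  exact_mod_cast this

lemma seqDeg_succ (ψ : ℕ → S) (n : ℕ) : seqDeg ψ (n + 1) = seqDeg ψ n * (ψ n).1.deg :=
  Finset.prod_range_succ _ _

/-- The `n`-th approximation of the canonical height. -/
noncomputable def heightApprox (ψ : ℕ → S) (n : ℕ) (P : P1 K) : ℝ :=
  (seqAct ψ n P).weilHeight / (seqDeg ψ n : ℝ)

variable (hdeg : ∀ φ ∈ S, 2 ≤ φ.deg) {C : ℝ}
  (hC : ∀ φ ∈ S, ∀ P : P1 K, |(φ.toFun P).weilHeight - φ.deg * P.weilHeight| ≤ C)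

include hdeg hC

lemma abs_heightApprox_succ_sub_le (ψ : ℕ → S) (P : P1 K) (n : ℕ) :
    |heightApprox ψ (n + 1) P - heightApprox ψ n P| ≤ C / 2 / 2 ^ n := by
  have h1 := two_pow_le_seqDeg hdeg ψ n
  have h2 := two_pow_le_seqDeg hdeg ψ (n + 1)
  have h0 : (0 : ℝ) < seqDeg ψ n := lt_of_lt_of_le (by positivity) h1
  have h0' : (0 : ℝ) < seqDeg ψ (n + 1) := lt_of_lt_of_le (by positivity) h2
  have h3 := hC _ (ψ n).2 (seqAct ψ n P)
  have hC0 : 0 ≤ C := (abs_nonneg _).trans h3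
  have hd : ((ψ n).1.deg : ℝ) ≠ 0 := by
    have := hdeg _ (ψ n).2
    positivity
  have key : heightApprox ψ (n + 1) P - heightApprox ψ n P =
      (((ψ n).1.toFun (seqAct ψ n P)).weilHeight - (ψ n).1.deg * (seqAct ψ n P).weilHeight) /
        seqDeg ψ (n + 1) := by
    simp only [heightApprox, seqAct, seqDeg_succ]
    push_cast
    field_simp
  rw [key, abs_div, abs_of_pos h0', div_div, ← pow_succ']
  gcongr

lemma tendsto_heightApprox (ψ : ℕ → S) (P : P1 K) :
    Tendsto (fun n ↦ heightApprox ψ n P) atTop (𝓝 (canonicalHeight ψ P)) := by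
  have h := cauchySeq_of_le_geometric_two (f := fun n ↦ heightApprox ψ n P) (C := C) fun n ↦ by
    rw [dist_comm, Real.dist_eq]
    exact abs_heightApprox_succ_sub_le hdeg hC ψ P n
  exact tendsto_nhds_limUnder (cauchySeq_tendsto_of_complete h)

lemma abs_heightApprox_sub_canonicalHeight_le (ψ : ℕ → S) (P : P1 K) (n : ℕ) :
    |heightApprox ψ n P - canonicalHeight ψ P| ≤ C / 2 ^ n := by
  have h := dist_le_of_le_geometric_two_of_tendsto (f := fun n ↦ heightApprox ψ n P) (C := C)
    (fun n ↦ by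
      rw [dist_comm, Real.dist_eq]
      exact abs_heightApprox_succ_sub_le hdeg hC ψ P n) (tendsto_heightApprox hdeg hC ψ P) n
  rwa [Real.dist_eq] at h

lemma weilHeight_sub_le_canonicalHeight (ψ : ℕ → S) (P : P1 K) :
    P.weilHeight - C ≤ canonicalHeight ψ P := by
  have h := abs_heightApprox_sub_canonicalHeight_le hdeg hC ψ P 0
  simp only [heightApprox, seqAct, seqDeg, Finset.range_zero, Finset.prod_empty, Nat.cast_one,
    div_one, pow_zero] at h
  linarith [(abs_le.mp h).2]

/-- Since `S` is finite, the space of sequences in `S` is compact; the canonical height of a fixed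
point is a uniform limit of locally constant functions on it, so it attains its infimum. -/
lemma exists_forall_canonicalHeight_le [Finite S] [Nonempty S] (P : P1 K) :
    ∃ ψ₀ : ℕ → S, ∀ ψ : ℕ → S, canonicalHeight ψ₀ P ≤ canonicalHeight ψ P := by
  let _ : TopologicalSpace S := ⊥
  have : DiscreteTopology S := ⟨rfl⟩
  have hact (n : ℕ) : IsLocallyConstant fun ψ : ℕ → S ↦ seqAct ψ n P := by
    induction n with
    | zero => exact IsLocallyConstant.const P
    | succ n ih =>
      have h1 : IsLocallyConstant fun ψ : ℕ → S ↦ ψ n :=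
        (IsLocallyConstant.iff_continuous _).mpr (continuous_apply n)
      exact h1.comp₂ ih fun φ Q ↦ φ.1.toFun Q
  have hdg (n : ℕ) : IsLocallyConstant fun ψ : ℕ → S ↦ seqDeg ψ n := by
    induction n with
    | zero => exact IsLocallyConstant.const (X := ℕ → S) 1
    | succ n ih =>
      have h1 : IsLocallyConstant fun ψ : ℕ → S ↦ ψ n :=
        (IsLocallyConstant.iff_continuous _).mpr (continuous_apply n)
      simp only [seqDeg_succ]
      exact ih.comp₂ h1 fun m φ ↦ m * φ.1.deg
  have hcont (n : ℕ) : Continuous fun ψ : ℕ → S ↦ heightApprox ψ n P :=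
    ((hact n).comp₂ (hdg n) fun Q m ↦ Q.weilHeight / (m : ℝ)).continuous
  have hunif : TendstoUniformly (fun n (ψ : ℕ → S) ↦ heightApprox ψ n P)
      (fun ψ ↦ canonicalHeight ψ P) atTop := by
    rw [Metric.tendstoUniformly_iff]
    intro ε hε
    have hlim : Tendsto (fun n : ℕ ↦ C / 2 ^ n) atTop (𝓝 0) := by
      have := (tendsto_pow_atTop_nhds_zero_of_lt_one (r := (2⁻¹ : ℝ)) (by norm_num)
        (by norm_num)).const_mul C
      simpa [div_eq_mul_inv] using this
    filter_upwards [hlim.eventually_lt_const hε] with n hn ψ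
    rw [dist_comm, Real.dist_eq]
    exact (abs_heightApprox_sub_canonicalHeight_le hdeg hC ψ P n).trans_lt hn
  have hc : Continuous fun ψ : ℕ → S ↦ canonicalHeight ψ P :=
    hunif.continuous (Frequently.of_forall hcont)
  obtain ⟨ψ₀, -, h⟩ := isCompact_univ.exists_isMinOn Set.univ_nonempty hc.continuousOn
  exact ⟨ψ₀, fun ψ ↦ h (Set.mem_univ ψ)⟩

end CanonicalHeights

section Reduction

open IntermediateField

variable {K : Type*} [Field K]

lemma P1.eq_of_coord_eq (P Q : P1 K) (h : P.coord = Q.coord) (hP : P.rep 1 ≠ 0)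
    (hQ : Q.rep 1 ≠ 0) : P = Q := by
  rw [← P.mk_rep, ← Q.mk_rep, Projectivization.mk_eq_mk_iff']
  refine ⟨P.rep 1 / Q.rep 1, ?_⟩
  rw [P1.coord, P1.coord, div_eq_div_iff hP hQ] at h
  ext i
  fin_cases i
  · simp only [Fin.zero_eta, Pi.smul_apply, smul_eq_mul]
    field_simp
    linear_combination -h
  · simp [div_mul_cancel₀ _ hQ]

lemma P1.eq_of_rep_one_eq_zero (P Q : P1 K) (hP : P.rep 1 = 0) (hQ : Q.rep 1 = 0) : P = Q := by
  have hP0 : P.rep 0 ≠ 0 := fun h ↦ P.rep_nonzero (by ext i; fin_cases i <;> simpa)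
  have hQ0 : Q.rep 0 ≠ 0 := fun h ↦ Q.rep_nonzero (by ext i; fin_cases i <;> simpa)
  rw [← P.mk_rep, ← Q.mk_rep, Projectivization.mk_eq_mk_iff']
  refine ⟨P.rep 0 / Q.rep 0, ?_⟩
  ext i
  fin_cases i
  · simp [div_mul_cancel₀ _ hQ0]
  · simp [hP, hQ]

lemma P1.finite_preimage_coord {T : Set (AlgebraicClosure K)} (hT : T.Finite) :
    {P : P1 K | P.coord ∈ T}.Finite := by
  have h1 : {P : P1 K | P.coord ∈ T ∧ P.rep 1 ≠ 0}.Finite :=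
    Set.Finite.of_finite_image (f := P1.coord) (hT.subset (by rintro _ ⟨P, hP, rfl⟩; exact hP.1))
      fun P hP Q hQ h ↦ P1.eq_of_coord_eq P Q h hP.2 hQ.2
  have h2 : {P : P1 K | P.rep 1 = 0}.Finite :=
    Set.Subsingleton.finite fun P hP Q hQ ↦ P1.eq_of_rep_one_eq_zero P Q hP hQ
  refine (h1.union h2).subset fun P hP ↦ ?_
  by_cases h : P.rep 1 = 0
  · exact Or.inr h
  · exact Or.inl ⟨hP, h⟩

/-- The formal part of the argument: it uses only that the height is an absolute Weil height with
the Northcott property over an infinite field. -/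
theorem canonicalHeight_lower_bound_of_northcott [Infinite K]
    (hh : IsAbsoluteWeilHeight (affineWeilHeight K))
    (hN : ∀ (D : ℕ) (B : ℝ), {x : AlgebraicClosure K |
      Module.finrank K K⟮x⟯ ≤ D ∧ affineWeilHeight K x ≤ B}.Finite)
    (S : Set (P1Endo K)) (hfin : S.Finite) (hne : S.Nonempty) (hdeg : ∀ φ ∈ S, 2 ≤ φ.deg)
    (D : ℕ) (hD : 0 < D) :
    (∀ (ψ : ℕ → S) (α : P1 K), Filter.Tendsto
      (fun n ↦ (seqAct ψ n α).weilHeight / (seqDeg ψ n : ℝ)) Filter.atTop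
      (nhds (canonicalHeight ψ α))) ∧
    0 < sInf {r : ℝ | ∃ (ψ : ℕ → S) (α : P1 K),
      α.degree ≤ D ∧ α ∉ prePer S ∧ r = canonicalHeight ψ α} := by
  have : Finite S := hfin
  have : Nonempty S := hne.to_subtype
  obtain ⟨C, hC⟩ : ∃ C, ∀ φ ∈ S, ∀ P : P1 K,
      |(φ.toFun P).weilHeight - φ.deg * P.weilHeight| ≤ C := by
    choose c hc using hh.exists_abs_sub_le
    obtain ⟨C, hC⟩ := (hfin.image c).bddAbove
    exact ⟨C, fun φ hφ P ↦ (hc φ P).trans (hC ⟨φ, hφ, rfl⟩)⟩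
  refine ⟨tendsto_heightApprox hdeg hC, ?_⟩
  have hnonneg (ψ : ℕ → S) (P : P1 K) : 0 ≤ canonicalHeight ψ P :=
    ge_of_tendsto' (tendsto_heightApprox hdeg hC ψ P) fun n ↦
      div_nonneg (hh.nonneg _) (Nat.cast_nonneg _)
  -- A point of `ℙ¹(K)` of height larger than `C` lies outside `PrePer`.
  obtain ⟨α₀, hα₀D, hα₀⟩ : ∃ α : P1 K, α.degree ≤ D ∧ C < α.weilHeight := by
    by_contra! hcon
    have hcoord (c : K) : P1.coord (Projectivization.mk (AlgebraicClosure K)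
        (![algebraMap K _ c, 1] : Fin 2 → AlgebraicClosure K) (by simp) : P1 K) =
          algebraMap K _ c := by
      rw [P1.coord_mk]; simp
    have h1 (c : K) : Module.finrank K K⟮algebraMap K (AlgebraicClosure K) c⟯ ≤ D := by
      have : K⟮algebraMap K (AlgebraicClosure K) c⟯ = ⊥ := by
        rw [adjoin_simple_eq_bot_iff]
        exact (⊥ : IntermediateField K (AlgebraicClosure K)).algebraMap_mem c
      rw [this, IntermediateField.finrank_bot]
      exact hD
    refine Set.infinite_range_of_injective (algebraMap K (AlgebraicClosure K)).injective
      ((hN D C).subset ?_)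
    rintro _ ⟨c, rfl⟩
    refine ⟨h1 c, ?_⟩
    have h2 := hcon (Projectivization.mk (AlgebraicClosure K)
        (![algebraMap K _ c, 1] : Fin 2 → AlgebraicClosure K) (by simp))
    rw [P1.degree, P1.weilHeight, hcoord] at h2
    exact h2 (h1 c)
  have hα₀per : α₀ ∉ prePer S := by
    rintro ⟨ψ, hψ⟩
    linarith [weilHeight_sub_le_canonicalHeight hdeg hC ψ α₀]
  -- Apart from finitely many points, the canonical heights are at least `1`; over the remaining
  -- points, take the least of the positive lower bounds `δ α`.
  have hfinQ : {α : P1 K | α.degree ≤ D ∧ α.weilHeight ≤ C + 1}.Finite :=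
    (P1.finite_preimage_coord (hN D (C + 1))).subset fun α hα ↦ hα
  have hpos (α : P1 K) : ∃ δ > 0, α ∉ prePer S → ∀ ψ : ℕ → S, δ ≤ canonicalHeight ψ α := by
    by_cases hα : α ∈ prePer S
    · exact ⟨1, one_pos, fun h ↦ (h hα).elim⟩
    · obtain ⟨ψ₀, h₀⟩ := exists_forall_canonicalHeight_le hdeg hC α
      exact ⟨canonicalHeight ψ₀ α, lt_of_le_of_ne (hnonneg _ _) fun h ↦ hα ⟨ψ₀, h.symm⟩,
        fun _ ↦ h₀⟩
  choose δ hδ hδ' using hpos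
  obtain ⟨ε, hε, hε'⟩ : ∃ ε > 0, ∀ α ∈ {α : P1 K | α.degree ≤ D ∧ α.weilHeight ≤ C + 1},
      ε ≤ δ α := by
    rcases Set.eq_empty_or_nonempty {α : P1 K | α.degree ≤ D ∧ α.weilHeight ≤ C + 1} with h | h
    · exact ⟨1, one_pos, by simp [h]⟩
    · obtain ⟨α, -, hα⟩ := Set.exists_min_image _ δ hfinQ h
      exact ⟨δ α, hδ α, hα⟩
  refine lt_of_lt_of_le (lt_min one_pos hε) (le_csInf ?_ ?_)
  · exact ⟨_, Classical.arbitrary _, α₀, hα₀D, hα₀per, rfl⟩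
  · rintro r ⟨ψ, α, hαD, hα, rfl⟩
    by_cases hle : α.weilHeight ≤ C + 1
    · exact (min_le_right _ _).trans ((hε' α ⟨hαD, hle⟩).trans (hδ' α hα ψ))
    · refine (min_le_left _ _).trans ?_
      linarith [weilHeight_sub_le_canonicalHeight hdeg hC ψ α]

end Reduction

/-! ### Heights over number fields -/

namespace NumberField

open Height IntermediateField

section Extension

variable (M L : Type*) [Field M] [NumberField M] [Field L] [NumberField L] [Algebra M L]

variable {M} in
lemma prod_infinitePlace_pow_mult_eq_prod_embeddings (F : InfinitePlace M → ℝ) :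
    ∏ v : InfinitePlace M, F v ^ v.mult = ∏ φ : M →+* ℂ, F (InfinitePlace.mk φ) := by
  classical
  rw [← Finset.prod_fiberwise Finset.univ (fun φ : M →+* ℂ ↦ InfinitePlace.mk φ)]
  refine Finset.prod_congr rfl fun v _ ↦ ?_
  rw [Finset.prod_congr rfl fun φ hφ ↦ by rw [(Finset.mem_filter.mp hφ).2], Finset.prod_const,
    InfinitePlace.card_filter_mk_eq]

lemma card_filter_comp_algebraMap_eq (φ : M →+* ℂ) [DecidableEq (M →+* ℂ)] :
    (Finset.univ.filter fun ψ : L →+* ℂ ↦ ψ.comp (algebraMap M L) = φ).card =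
      Module.finrank M L := by
  let _ := φ.toAlgebra
  have : FiniteDimensional M L := Module.Finite.right ℚ M L
  rw [← AlgHom.card M L ℂ, ← Fintype.card_subtype]
  refine Fintype.card_congr
    { toFun := fun ψ ↦ { ψ.1 with commutes' := fun r ↦ congrArg (fun f : M →+* ℂ ↦ f r) ψ.2 }
      invFun := fun ψ ↦ ⟨ψ.toRingHom, RingHom.ext fun r ↦ ψ.commutes r⟩
      left_inv := fun ψ ↦ rfl
      right_inv := fun ψ ↦ rfl }

lemma prod_embeddings_comp_algebraMap (F : (M →+* ℂ) → ℝ) :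
    ∏ ψ : L →+* ℂ, F (ψ.comp (algebraMap M L)) = (∏ φ : M →+* ℂ, F φ) ^ Module.finrank M L := by
  classical
  rw [← Finset.prod_fiberwise Finset.univ (fun ψ : L →+* ℂ ↦ ψ.comp (algebraMap M L)),
    ← Finset.prod_pow]
  refine Finset.prod_congr rfl fun φ _ ↦ ?_
  rw [Finset.prod_congr rfl fun ψ hψ ↦ by rw [(Finset.mem_filter.mp hψ).2], Finset.prod_const,
    ← card_filter_comp_algebraMap_eq M L φ]

variable {M} in
lemma mulHeight_mul_absNorm_span_eq {x : Fin 2 → 𝓞 M} (hx : x ≠ 0) :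
    mulHeight (fun i ↦ (x i : M)) * (Ideal.span (Set.range x)).absNorm =
      ∏ φ : M →+* ℂ, ⨆ i, ‖φ (x i)‖ := by
  have hx' : (fun i ↦ (x i : M)) ≠ 0 := by
    obtain ⟨i, hi⟩ := Function.ne_iff.mp hx
    exact Function.ne_iff.mpr ⟨i, by simpa using hi⟩
  have h1 := absNorm_mul_finprod_finitePlace_eq_one hx
  rw [NumberField.mulHeight_eq hx', mul_assoc, mul_comm (∏ᶠ _, _), h1, mul_one,
    prod_infinitePlace_pow_mult_eq_prod_embeddings (fun v ↦ ⨆ i, v (x i : M))]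
  simp only [InfinitePlace.apply]

/-- The height of an element of `M` is raised to the power `[L : M]` in a finite extension `L`:
the archimedean part because each embedding of `M` has `[L : M]` extensions to `L`, the
nonarchimedean part because it is the inverse of the norm of an ideal. -/
theorem mulHeight₁_algebraMap (x : M) :
    mulHeight₁ (algebraMap M L x) = mulHeight₁ x ^ Module.finrank M L := by
  obtain ⟨a, b, hb, rfl⟩ := IsFractionRing.div_surjective (A := 𝓞 M) x
  have hb0 : b ≠ 0 := nonZeroDivisors.ne_zero hb
  set f : 𝓞 M →+* 𝓞 L := algebraMap (𝓞 M) (𝓞 L)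
  have hx : (![a, b] : Fin 2 → 𝓞 M) ≠ 0 := fun h ↦ hb0 (congrFun h 1)
  have hfb : f b ≠ 0 := by
    rwa [Ne, FaithfulSMul.algebraMap_eq_zero_iff]
  have hy : (![f a, f b] : Fin 2 → 𝓞 L) ≠ 0 := fun h ↦ hfb (congrFun h 1)
  have hcomm (c : 𝓞 M) : ((f c : 𝓞 L) : L) = algebraMap M L c := rfl
  have h1 := mulHeight_mul_absNorm_span_eq hx
  have h2 := mulHeight_mul_absNorm_span_eq hy
  have hspan : Ideal.span (Set.range ![f a, f b]) =
      (Ideal.span (Set.range ![a, b])).map f := by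
    rw [Ideal.map_span, ← Set.range_comp]
    congr 2; ext i; fin_cases i <;> rfl
  have hrank : Module.finrank (𝓞 M) (𝓞 L) = Module.finrank M L :=
    (IsFractionRing.finrank_eq (𝓞 M) M (𝓞 L) L).symm
  have h3 : ∏ ψ : L →+* ℂ, ⨆ i, ‖ψ (![f a, f b] i)‖ =
      (∏ φ : M →+* ℂ, ⨆ i, ‖φ (![a, b] i)‖) ^ Module.finrank M L := by
    rw [← prod_embeddings_comp_algebraMap]
    refine Finset.prod_congr rfl fun ψ _ ↦ ?_
    congr 1; ext i; fin_cases i <;> rfl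
  have hN : ((Ideal.span (Set.range ![a, b])).absNorm : ℝ) ≠ 0 := by
    rw [Nat.cast_ne_zero, Ne, Ideal.absNorm_eq_zero_iff]
    intro h0
    exact hb0 (by simpa using (Ideal.span_eq_bot.mp h0) b ⟨1, rfl⟩)
  rw [h3, ← h1, hspan, Ideal.absNorm_algebraMap, hrank, mul_pow, Nat.cast_pow] at h2
  have h4 := mul_right_cancel₀ (pow_ne_zero _ hN) h2
  rw [map_div₀, mulHeight₁_div_eq_mulHeight, mulHeight₁_div_eq_mulHeight]
  convert! h4 using 2
  · ext i; fin_cases i <;> rfl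
  · congr 1; ext i; fin_cases i <;> rfl

end Extension

/-- The absolute height can be computed in any number field containing the element. -/
theorem logHeight₁_eq_finrank_mul_absLogHeight₁ {E L : Type*} [Field E] [CharZero E] [Field L]
    [NumberField L] (f : L →+* E) (x : L) :
    logHeight₁ x = Module.finrank ℚ L * absLogHeight₁ (f x) := by
  let f' : L →ₐ[ℚ] E := f.toRatAlgHom
  have hint : IsIntegral ℚ (f x) := (Algebra.IsIntegral.isIntegral (R := ℚ) x).map f'
  have : FiniteDimensional ℚ ℚ⟮f x⟯ := adjoin.finiteDimensional hint
  have : NumberField ℚ⟮f x⟯ := {}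
  have hle : ℚ⟮f x⟯.toSubalgebra ≤ f'.range := by
    change ℚ⟮f x⟯ ≤ f'.fieldRange
    rw [adjoin_simple_le_iff]
    exact ⟨x, rfl⟩
  let g : ℚ⟮f x⟯ →+* L :=
    ((AlgEquiv.ofInjective f' f'.toRingHom.injective).symm.toAlgHom.comp
      (Subalgebra.inclusion hle)).toRingHom
  have hg (z : ℚ⟮f x⟯) : f (g z) = z := by
    have h := (AlgEquiv.ofInjective f' f'.toRingHom.injective).apply_symm_apply
      (Subalgebra.inclusion hle z)
    exact congrArg Subtype.val h
  let _ : Algebra ℚ⟮f x⟯ L := g.toAlgebra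
  have hgx : algebraMap ℚ⟮f x⟯ L (AdjoinSimple.gen ℚ (f x)) = x := f.injective (hg _)
  have h1 := mulHeight₁_algebraMap ℚ⟮f x⟯ L (AdjoinSimple.gen ℚ (f x))
  rw [hgx] at h1
  have hn : (Module.finrank ℚ ℚ⟮f x⟯ : ℝ) ≠ 0 := by
    exact_mod_cast (Module.finrank_pos (R := ℚ) (M := ℚ⟮f x⟯)).ne'
  rw [logHeight₁, h1, Real.log_pow, absLogHeight₁, absMulHeight₁, dif_pos hint, Real.log_rpow
    (mulHeight₁_pos _), ← Module.finrank_mul_finrank ℚ ℚ⟮f x⟯ L]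
  push_cast
  field_simp

/-- The absolute height is an absolute Weil height in the sense of `IsAbsoluteWeilHeight`. -/
theorem isAbsoluteWeilHeight_absLogHeight₁ (K : Type*) [Field K] [NumberField K] :
    IsAbsoluteWeilHeight (absLogHeight₁ : AlgebraicClosure K → ℝ) := by
  refine ⟨1, fun T hT ↦ ?_⟩
  let L : IntermediateField K (AlgebraicClosure K) := adjoin K T
  have : Finite T := hT
  have : FiniteDimensional K L :=
    finiteDimensional_adjoin fun x _ ↦ Algebra.IsIntegral.isIntegral x
  have : FiniteDimensional ℚ L := FiniteDimensional.trans ℚ K L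
  have : NumberField L := {}
  refine ⟨L, inferInstance, Module.finrank ℚ L, ?_, subset_adjoin K T, ?_, fun x ↦ ?_⟩
  · exact_mod_cast Module.finrank_pos
  · rw [totalWeight_eq_finrank, one_mul]
  · exact logHeight₁_eq_finrank_mul_absLogHeight₁ (algebraMap L (AlgebraicClosure K)) x

lemma norm_embedding_le_mulHeight₁ {L : Type*} [Field L] [NumberField L] (x : L) (φ : L →+* ℂ) :
    ‖φ x‖ ≤ mulHeight₁ x := by
  classical
  rw [NumberField.mulHeight₁_eq]
  have h1 : ‖φ x‖ ≤ ∏ v : InfinitePlace L, max (v x) 1 ^ v.mult := by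
    have hone (v : InfinitePlace L) : 1 ≤ max (v x) 1 ^ v.mult := one_le_pow₀ (le_max_right _ _)
    calc ‖φ x‖ = InfinitePlace.mk φ x := (InfinitePlace.apply φ x).symm
      _ ≤ max (InfinitePlace.mk φ x) 1 := le_max_left _ _
      _ ≤ max (InfinitePlace.mk φ x) 1 ^ (InfinitePlace.mk φ).mult :=
        le_self_pow₀ (le_max_right _ _) InfinitePlace.mult_ne_zero
      _ ≤ _ := by
        rw [← Finset.mul_prod_erase _ _ (Finset.mem_univ (InfinitePlace.mk φ))]
        exact le_mul_of_one_le_right (by positivity)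
          (Finset.prod_induction _ (1 ≤ ·) (fun _ _ ↦ one_le_mul_of_one_le_of_one_le) le_rfl
            fun v _ ↦ hone v)
  exact h1.trans (le_mul_of_one_le_right ((norm_nonneg _).trans h1)
    (one_le_finprod fun _ ↦ le_max_right _ _))

/-- Northcott's theorem for the absolute height: an algebraic number of bounded degree and height
becomes, after multiplication by a bounded denominator, an algebraic integer with bounded
conjugates, that is, a root of one of finitely many integer polynomials. -/
theorem finite_setOf_finrank_le_absLogHeight₁_le (E : Type*) [Field E] [CharZero E]
    [Algebra.IsAlgebraic ℚ E] (D : ℕ) (B : ℝ) :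
    {x : E | Module.finrank ℚ ℚ⟮x⟯ ≤ D ∧ absLogHeight₁ x ≤ B}.Finite := by
  classical
  set H := Real.exp (D * |B|) with hH
  have hH1 : 1 ≤ H := Real.one_le_exp (by positivity)
  set C : ℝ := (H * H) ^ D * 2 ^ D with hC
  have hfin : {c : ℤ | |(c : ℝ)| ≤ C}.Finite := by
    refine (Set.finite_Icc (-⌊C⌋) ⌊C⌋).subset fun c hc ↦ ?_
    have : |c| ≤ ⌊C⌋ := Int.le_floor.mpr (by simpa using hc)
    exact abs_le.mp this
  have hroots := Polynomial.bUnion_roots_finite (algebraMap ℤ E) D hfin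
  refine (Set.Finite.image2 (fun (y : E) (n : ℕ) ↦ y / n) hroots (Set.finite_Iic ⌊H⌋₊)).subset ?_
  rintro x ⟨hD, hB⟩
  have hint : IsIntegral ℚ x := (Algebra.IsAlgebraic.isAlgebraic x).isIntegral
  have : FiniteDimensional ℚ ℚ⟮x⟯ := adjoin.finiteDimensional hint
  have : NumberField ℚ⟮x⟯ := {}
  set g := AdjoinSimple.gen ℚ x
  have hgx : algebraMap ℚ⟮x⟯ E g = x := AdjoinSimple.algebraMap_gen ℚ x
  have hgH : mulHeight₁ g ≤ H := by
    have h1 := logHeight₁_eq_finrank_mul_absLogHeight₁ (algebraMap ℚ⟮x⟯ E) g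
    rw [hgx, logHeight₁] at h1
    rw [← Real.exp_log (mulHeight₁_pos g), h1, hH, Real.exp_le_exp]
    calc (Module.finrank ℚ ℚ⟮x⟯ : ℝ) * absLogHeight₁ x ≤ Module.finrank ℚ ℚ⟮x⟯ * |B| := by
          gcongr; exact hB.trans (le_abs_self B)
      _ ≤ D * |B| := by gcongr
  obtain ⟨n, hn0, hnH, hn⟩ := exists_nat_le_mulHeight₁ g
  have hbd (φ : ℚ⟮x⟯ →+* ℂ) : ‖φ (n * g)‖ ≤ H * H := by
    rw [map_mul, norm_mul, map_natCast, Complex.norm_natCast]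
    gcongr
    · exact hnH.trans hgH
    · exact (norm_embedding_le_mulHeight₁ g φ).trans hgH
  have hmin : minpoly ℚ ((n : ℚ⟮x⟯) * g) = (minpoly ℤ ((n : ℚ⟮x⟯) * g)).map (algebraMap ℤ ℚ) :=
    minpoly.isIntegrallyClosed_eq_field_fractions' ℚ hn
  refine ⟨n * x, ?_, n, Nat.le_floor (hnH.trans hgH), ?_⟩
  · simp only [Set.mem_iUnion]
    refine ⟨minpoly ℤ ((n : ℚ⟮x⟯) * g), ⟨?_, fun i ↦ ?_⟩, ?_⟩
    · rw [← (minpoly.monic hn).natDegree_map (algebraMap ℤ ℚ), ← hmin]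
      exact (minpoly.natDegree_le _).trans hD
    · have h1 := Embeddings.coeff_bdd_of_norm_le hbd i
      rw [hmin, Polynomial.coeff_map, max_eq_left (one_le_mul_of_one_le_of_one_le hH1 hH1)] at h1
      have h2 : |(((minpoly ℤ ((n : ℚ⟮x⟯) * g)).coeff i : ℤ) : ℝ)| =
          ‖algebraMap ℤ ℚ ((minpoly ℤ ((n : ℚ⟮x⟯) * g)).coeff i)‖ := by
        simp [Int.norm_eq_abs]
      rw [Set.mem_ofPred_eq, h2]
      refine h1.trans ?_
      rw [hC]
      gcongr
      · exact one_le_mul_of_one_le_of_one_le hH1 hH1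
      · exact_mod_cast (Nat.choose_le_two_pow _ _).trans (Nat.pow_le_pow_right two_pos hD)
    · simp only [Finset.mem_coe, Multiset.mem_toFinset]
      rw [Polynomial.mem_roots ((minpoly.monic hn).map _).ne_zero, Polynomial.IsRoot,
        Polynomial.eval_map_algebraMap]
      have h1 := congrArg (algebraMap ℚ⟮x⟯ E) (minpoly.aeval ℤ ((n : ℚ⟮x⟯) * g))
      rw [← Polynomial.aeval_algebraMap_apply, map_zero, map_mul, map_natCast, hgx] at h1
      exact h1
  · have : (n : E) ≠ 0 := Nat.cast_ne_zero.mpr hn0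
    simp [this]

end NumberField

/-! ### Quotients of subrings of function fields -/

/-- The property of a field extension `L / F` of being a function field in one variable, in the
form in which it is used: `L / F` is transcendental, and `L` has finite degree over `F(x)` for
every transcendental `x`. -/
structure IsFunctionFieldInOneVariable (F L : Type*) [Field F] [Field L] [Algebra F L] : Prop where
  exists_transcendental : ∃ t : L, Transcendental F t
  finiteDimensional_adjoin : ∀ x : L, Transcendental F x →
    FiniteDimensional (IntermediateField.adjoin F {x}) L

section Quotient

open IntermediateField Polynomial

variable {F L : Type*} [Field F] [Field L] [Algebra F L]

lemma forall_eq_zero_of_sum_aeval_mul_eq_zero {R : Subalgebra F L} {y : R}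
    (hy : Transcendental F (y : L)) {Q : Type*} [CommRing Q] [Algebra F Q]
    (π : R →ₐ[F] Q) (hπ : π y = 0) {ι : Type*} [Fintype ι] {b : ι → R}
    (hb : LinearIndependent F fun i ↦ π (b i))
    (n : ℕ) (P : ι → F[X]) (hP : ∀ i, (P i).degree < n) (h0 : ∑ i, aeval y (P i) * b i = 0) :
    ∀ i, P i = 0 := by
  have hy0 : y ≠ 0 := by
    rintro rfl
    exact hy (by simpa using isAlgebraic_zero)
  induction n generalizing P with
  | zero => exact fun i ↦ by simpa using hP i
  | succ n ih =>
    have hdec (i : ι) :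
        aeval y (P i) = y * aeval y (P i).divX + algebraMap F R ((P i).coeff 0) := by
      conv_lhs => rw [← divX_mul_X_add (P i)]
      rw [map_add, map_mul, aeval_X, aeval_C, mul_comm]
    have hc : ∀ i, (P i).coeff 0 = 0 := by
      refine Fintype.linearIndependent_iff.mp hb _ ?_
      have h1 := congrArg π h0
      simp only [hdec, map_sum, map_mul, map_add, map_zero, hπ, zero_mul, zero_add,
        AlgHom.commutes] at h1
      rw [← h1]
      exact Finset.sum_congr rfl fun i _ ↦ Algebra.smul_def _ _
    have h2 : ∑ i, aeval y (P i).divX * b i = 0 := by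
      apply mul_left_cancel₀ hy0
      rw [mul_zero, ← h0, Finset.mul_sum]
      refine Finset.sum_congr rfl fun i _ ↦ ?_
      rw [hdec i, hc i, map_zero, add_zero, mul_assoc]
    have h3 := ih (fun i ↦ (P i).divX) (fun i ↦ ?_) h2
    · intro i
      rw [← divX_mul_X_add (P i), h3 i, hc i]; simp
    · by_cases hi : P i = 0
      · simp [hi]
      · have h4 := degree_divX_lt hi
        have h5 := hP i
        rw [degree_eq_natDegree hi] at h4 h5
        by_cases hd : (P i).divX = 0
        · simp [hd]
        · rw [degree_eq_natDegree hd] at h4 ⊢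
          norm_cast at *
          lia

open scoped IntermediateField.algebraAdjoinAdjoin in
/-- Elements of a subring `R` which are linearly independent over `F` modulo `y` are linearly
independent over `F(y)`: clear denominators and compare the lowest order terms in `y`. -/
lemma linearIndependent_adjoin_of_quotient {R : Subalgebra F L} {y : R}
    (hy : Transcendental F (y : L)) {Q : Type*} [CommRing Q] [Algebra F Q]
    (π : R →ₐ[F] Q) (hπ : π y = 0) {ι : Type*} [Fintype ι] {b : ι → R}
    (hb : LinearIndependent F fun i ↦ π (b i)) :
    LinearIndependent F⟮(y : L)⟯ fun i ↦ (b i : L) := by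
  rw [← LinearIndependent.iff_fractionRing (R := Algebra.adjoin F {(y : L)}) (K := F⟮(y : L)⟯),
    Fintype.linearIndependent_iff]
  intro g hg
  have hg' (i : ι) : ∃ P : F[X], aeval (y : L) P = g i := by
    have h : ∀ z ∈ Algebra.adjoin F {(y : L)}, ∃ P : F[X], aeval (y : L) P = z := by
      rw [Algebra.adjoin_singleton_eq_range_aeval]
      exact fun z hz ↦ hz
    exact h _ (g i).2
  choose P hP using hg'
  have h1 : ∑ i, aeval y (P i) * b i = 0 := by
    apply Subtype.ext
    rw [AddSubmonoidClass.coe_finsetSum, ZeroMemClass.coe_zero, ← hg]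
    refine Finset.sum_congr rfl fun i _ ↦ ?_
    rw [MulMemClass.coe_mul, Subalgebra.smul_def, ← hP i, smul_eq_mul]
    congr 1
    exact (aeval_algebraMap_apply L y (P i)).symm
  have h2 := forall_eq_zero_of_sum_aeval_mul_eq_zero hy π hπ hb
    (Finset.univ.sup (fun i ↦ (P i).natDegree) + 1) P (fun i ↦ ?_) h1
  · intro i
    apply Subtype.ext
    rw [← hP i, h2 i]; simp
  · refine degree_le_natDegree.trans_lt ?_
    exact_mod_cast Nat.lt_succ_of_le
      (Finset.le_sup (f := fun i ↦ (P i).natDegree) (Finset.mem_univ i))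

/-- A quotient of `R` in which `y` vanishes has at most `#F ^ [L : F(y)]` elements. -/
lemma finite_and_card_le_of_surjective [Finite F] {R : Subalgebra F L} {y : R}
    (hy : Transcendental F (y : L)) [FiniteDimensional F⟮(y : L)⟯ L] {Q : Type*} [CommRing Q]
    (π : R →+* Q) (hπ : Function.Surjective π) (hπy : π y = 0) :
    Finite Q ∧ Nat.card Q ≤ Nat.card F ^ Module.finrank F⟮(y : L)⟯ L := by
  let _ : Algebra F Q := (π.comp (algebraMap F R)).toAlgebra
  let π' : R →ₐ[F] Q := { π with commutes' := fun _ ↦ rfl }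
  have h1 : Module.rank F Q ≤ Module.finrank F⟮(y : L)⟯ L := by
    refine rank_le fun s hs ↦ ?_
    choose b hb using fun i : s ↦ hπ i
    have := linearIndependent_adjoin_of_quotient hy π' hπy (b := b)
      (by convert hs using 2 with i; exact hb i)
    simpa using this.fintype_card_le_finrank
  have h2 : Module.Finite F Q :=
    Module.rank_lt_aleph0_iff.mp (h1.trans_lt (Cardinal.natCast_lt_aleph0))
  refine ⟨Module.finite_of_finite F, ?_⟩
  rw [Module.natCard_eq_pow_finrank (K := F)]
  refine Nat.pow_le_pow_right Nat.card_pos ?_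
  rw [← Module.finrank_eq_rank] at h1
  exact_mod_cast h1

end Quotient

/-! ### Places of function fields -/

section Places

open IntermediateField IsLocalRing

variable {F L : Type*} [Field F] [Field L] [Algebra F L]

/-- A subring integrally closed in `L` contains the finite field `F`. -/
lemma ValuationSubring.algebraMap_mem_of_finite [Finite F] (A : ValuationSubring L) (c : F) :
    algebraMap F L c ∈ A := by
  have := Fintype.ofFinite F
  by_cases hc : c = 0
  · simp [hc, A.zero_mem]
  have h1 : algebraMap F L c ^ (Fintype.card F - 1) = 1 := by
    rw [← map_pow, FiniteField.pow_card_sub_one_eq_one c hc, map_one]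
  have h2 : A.valuation (algebraMap F L c) = 1 := by
    have := congrArg A.valuation h1
    rw [map_pow, map_one] at this
    exact (pow_eq_one_iff_of_nonneg zero_le (Nat.sub_pos_of_lt Fintype.one_lt_card).ne').mp this
  exact (A.valuation_le_one_iff _).mp h2.le

/-- A valuation subring of an extension of a finite field `F`, as an `F`-subalgebra. -/
def ValuationSubring.toFiniteSubalgebra [Finite F] (A : ValuationSubring L) : Subalgebra F L :=
  { A.toSubring with algebraMap_mem' := A.algebraMap_mem_of_finite }

lemma ValuationSubring.transcendental_of_not_isUnit [Finite F] (A : ValuationSubring L) {y : A}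
    (hy0 : y ≠ 0) (hy : ¬ IsUnit y) : Transcendental F (y : L) := by
  intro halg
  apply hy
  have h1 : (y : L)⁻¹ ∈ A :=
    Subalgebra.inv_mem_of_algebraic (A := A.toFiniteSubalgebra (F := F)) (x := y) halg
  refine IsUnit.of_mul_eq_one ⟨(y : L)⁻¹, h1⟩ (Subtype.ext ?_)
  exact mul_inv_cancel₀ fun h ↦ hy0 (Subtype.ext h)

variable (hL : IsFunctionFieldInOneVariable F L)

include hL

lemma ValuationSubring.finite_quotient_and_card_le [Finite F] (A : ValuationSubring L) {y : A}
    (hy : Transcendental F (y : L)) :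
    Finite (A ⧸ Ideal.span {y}) ∧
      Nat.card (A ⧸ Ideal.span {y}) ≤ Nat.card F ^ Module.finrank F⟮(y : L)⟯ L := by
  have := hL.finiteDimensional_adjoin _ hy
  let π : A →+* A ⧸ Ideal.span {y} := Ideal.Quotient.mk _
  have h1 : Function.Surjective π := Ideal.Quotient.mk_surjective
  have h2 : π y = 0 := Ideal.Quotient.eq_zero_iff_mem.mpr (Ideal.mem_span_singleton_self y)
  exact finite_and_card_le_of_surjective (R := A.toFiniteSubalgebra) (y := y) hy π h1 h2

/-- All nonzero ideals of a valuation subring of a function field over a finite field have finite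
index, so nontrivial valuation subrings are places. -/
theorem ValuationSubring.isPlace_of_ne_top [Finite F] (A : ValuationSubring L) (hA : A ≠ ⊤) :
    IsDiscreteValuationRing A ∧ Finite (ResidueField A) := by
  have hq {y : A} (hy0 : y ≠ 0) : Finite (A ⧸ Ideal.span {y}) := by
    by_cases hu : IsUnit y
    · rw [Ideal.span_singleton_eq_top.mpr hu]
      infer_instance
    · exact (A.finite_quotient_and_card_le hL (A.transcendental_of_not_isUnit hy0 hu)).1
  have hfq : Ring.HasFiniteQuotients A := by
    refine ⟨fun {I} hI ↦ ?_⟩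
    obtain ⟨y, hyI, hy0⟩ := Submodule.exists_mem_ne_zero_of_ne_bot hI
    have := hq hy0
    exact Finite.of_surjective _ (Ideal.Quotient.factor_surjective
      ((Ideal.span_singleton_le_iff_mem I).mpr hyI))
  have hnf : ¬ IsField A := by
    intro hf
    refine hA (_root_.eq_top_iff.mpr fun x _ ↦ ?_)
    rcases A.mem_or_inv_mem x with h | h
    · exact h
    · by_cases hx : x = 0
      · simp [hx, A.zero_mem]
      obtain ⟨z, hz⟩ := hf.mul_inv_cancel (a := ⟨x⁻¹, h⟩)
        (fun h0 ↦ inv_ne_zero hx (congrArg Subtype.val h0))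
      have hz' : x⁻¹ * (z : L) = 1 := congrArg Subtype.val hz
      have : x = z := by
        field_simp at hz'
        exact hz'.symm
      rw [this]; exact z.2
  have hne : maximalIdeal A ≠ ⊥ := fun h ↦ hnf (isField_iff_maximalIdeal_eq.mpr h)
  exact ⟨{ not_a_field' := hne }, Ring.HasFiniteQuotients.finiteQuotient hne⟩

/-- Every transcendental element has a pole. -/
theorem FunctionFieldPlace.exists_inv_mem_nonunits [Finite F] {z : L} (hz : Transcendental F z) :
    ∃ v : FunctionFieldPlace L, z⁻¹ ∈ v.1.nonunits := by
  have hz0 : z ≠ 0 := fun h ↦ hz (h ▸ isAlgebraic_zero)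
  let R : Subring L := (Algebra.adjoin F {z⁻¹}).toSubring
  have hmem : z⁻¹ ∈ R := Algebra.self_mem_adjoin_singleton F z⁻¹
  have hne : Ideal.span {(⟨z⁻¹, hmem⟩ : R)} ≠ ⊤ := by
    intro htop
    obtain ⟨r, hr⟩ := (Ideal.mem_span_singleton.mp ((Ideal.eq_top_iff_one _).mp htop))
    have hr' : (1 : L) = z⁻¹ * (r : L) := congrArg Subtype.val hr
    have hzr : z = r := by field_simp at hr'; exact hr'
    have h : ∀ w ∈ Algebra.adjoin F {z⁻¹}, ∃ P : Polynomial F, Polynomial.aeval z⁻¹ P = w := by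
      rw [Algebra.adjoin_singleton_eq_range_aeval]
      exact fun z hz ↦ hz
    obtain ⟨P, hP⟩ := h _ r.2
    have halg : IsAlgebraic F z⁻¹ := by
      refine ⟨Polynomial.X * P - 1, fun h0 ↦ ?_, ?_⟩
      · have := congrArg (Polynomial.eval 0) h0
        simp at this
      · simp [hP, ← hzr, inv_mul_cancel₀ hz0]
    exact hz (by simpa using halg.inv)
  obtain ⟨B, -, hB⟩ := Ideal.image_subset_nonunits_valuationSubring _ hne
  have hzB : z⁻¹ ∈ B.nonunits := hB ⟨⟨z⁻¹, hmem⟩, Ideal.mem_span_singleton_self _, rfl⟩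
  refine ⟨⟨B, B.isPlace_of_ne_top hL ?_⟩, hzB⟩
  rintro rfl
  rw [ValuationSubring.mem_nonunits_iff] at hzB
  have h1 : (⊤ : ValuationSubring L).valuation z ≤ 1 :=
    (ValuationSubring.valuation_le_one_iff _ _).mpr trivial
  rw [map_inv₀] at hzB
  have h2 : (⊤ : ValuationSubring L).valuation z ≠ 0 := by simpa using hz0
  exact absurd hzB (not_lt.mpr (one_le_inv₀ (zero_lt_iff.mpr h2) |>.mpr h1))

end Places

/-! ### Absolute values of places -/

namespace FunctionFieldPlace

open IsLocalRing

variable {L : Type*} [Field L] (v w : FunctionFieldPlace L)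

instance : IsDiscreteValuationRing v.1 := v.2.1

instance : Finite (ResidueField v.1) := v.2.2

lemma isNonarchimedean_abv : IsNonarchimedean v.abv :=
  IsDedekindDomain.HeightOneSpectrum.isNonarchimedean_adicAbv _ _

lemma abv_coe_le_one (y : v.1) : v.abv (y : L) ≤ 1 :=
  IsDedekindDomain.HeightOneSpectrum.adicAbv_coe_le_one
    (IsDiscreteValuationRing.maximalIdeal v.1) v.one_lt_residueCard y

lemma abv_coe_lt_one_iff (y : v.1) : v.abv (y : L) < 1 ↔ ¬ IsUnit y := by
  refine (IsDedekindDomain.HeightOneSpectrum.adicAbv_coe_lt_one_iff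
    (IsDiscreteValuationRing.maximalIdeal v.1) v.one_lt_residueCard y).trans ?_
  exact mem_maximalIdeal y

lemma abv_coe_eq_one_iff (y : v.1) : v.abv (y : L) = 1 ↔ IsUnit y := by
  rw [← not_iff_not, ← abv_coe_lt_one_iff, lt_iff_le_and_ne]
  exact ⟨fun h ↦ ⟨v.abv_coe_le_one y, h⟩, fun h ↦ h.2⟩

lemma abv_le_one_iff (x : L) : v.abv x ≤ 1 ↔ x ∈ v.1 := by
  refine ⟨fun h ↦ ?_, fun h ↦ v.abv_coe_le_one ⟨x, h⟩⟩
  rcases v.1.mem_or_inv_mem x with hx | hx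
  · exact hx
  · by_cases hx0 : x = 0
    · simp [hx0, v.1.zero_mem]
    have h1 : v.abv x⁻¹ = 1 := by
      refine le_antisymm (v.abv_coe_le_one ⟨_, hx⟩) ?_
      rw [map_inv₀]
      exact one_le_inv₀ (v.abv.pos hx0) |>.mpr h
    obtain ⟨u, hu⟩ := (v.abv_coe_eq_one_iff ⟨_, hx⟩).mp h1
    have h2 : ((u⁻¹ : v.1ˣ) : v.1) * (x⁻¹ : L) = 1 := by
      have := congrArg (Subtype.val) (Units.inv_mul u)
      rw [MulMemClass.coe_mul, hu] at this
      exact this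
    rw [mul_inv_eq_one₀ hx0] at h2
    rw [← h2]
    exact SetLike.coe_mem _

lemma one_lt_abv_iff_inv_mem_nonunits (x : L) : 1 < v.abv x ↔ x ≠ 0 ∧ x⁻¹ ∈ v.1.nonunits := by
  rw [← not_le, abv_le_one_iff, ValuationSubring.mem_nonunits_iff,
    ← ValuationSubring.valuation_le_one_iff, not_le, map_inv₀]
  constructor
  · intro h
    have : x ≠ 0 := by rintro rfl; simp at h
    exact ⟨this, inv_lt_one_of_one_lt₀ h⟩
  · rintro ⟨h0, h⟩
    exact (inv_lt_one₀ (zero_lt_iff.mpr (by simpa using h0))).mp h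

/-- The normalised absolute value is the inverse of the module: `#(A / y A) = |y|⁻¹`. -/
lemma card_quotient_span_singleton {y : v.1} (hy : y ≠ 0) :
    (Nat.card (v.1 ⧸ Ideal.span {y}) : ℝ) = (v.abv (y : L))⁻¹ := by
  obtain ⟨π, hπ⟩ := IsDiscreteValuationRing.exists_irreducible v.1
  obtain ⟨n, u, rfl⟩ := IsDiscreteValuationRing.eq_unit_mul_pow_irreducible hy hπ
  have hm : maximalIdeal v.1 = Ideal.span {π} := hπ.maximalIdeal_eq
  have h1 : v.abv (u : v.1) = 1 := (v.abv_coe_eq_one_iff _).mpr u.isUnit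
  have h2 : v.abv (π : L) = (v.residueCard : ℝ)⁻¹ := by
    have h3 : (IsDiscreteValuationRing.maximalIdeal v.1).valuation L (π : L) =
        WithZero.exp (-1 : ℤ) := by
      refine (IsDedekindDomain.HeightOneSpectrum.valuation_of_algebraMap _ π).trans ?_
      exact IsDedekindDomain.HeightOneSpectrum.intValuation_singleton _ hπ.ne_zero hm
    change ((IsDiscreteValuationRing.maximalIdeal v.1).adicAbvDef v.one_lt_residueCard (π : L) : ℝ)
      = _
    rw [IsDedekindDomain.HeightOneSpectrum.adicAbvDef, h3]
    rw [WithZeroMulInt.toNNReal_neg_apply _ WithZero.exp_ne_zero]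
    change (((v.residueCard : NNReal) ^ (-1 : ℤ) : NNReal) : ℝ) = _
    simp
  have h3 : Ideal.span {(u : v.1) * π ^ n} = maximalIdeal v.1 ^ n := by
    rw [hm, Ideal.span_singleton_pow, mul_comm]
    exact Ideal.span_singleton_mul_right_unit u.isUnit _
  have h4 : Nat.card (v.1 ⧸ maximalIdeal v.1 ^ n) = Nat.card (v.1 ⧸ maximalIdeal v.1) ^ n :=
    cardQuot_pow_of_prime (IsDiscreteValuationRing.maximalIdeal v.1).ne_bot
  rw [h3, h4, MulMemClass.coe_mul, map_mul, h1, one_mul, SubmonoidClass.coe_pow, map_pow, h2,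
    inv_pow, inv_inv]
  push_cast
  rfl

lemma isNontrivial_abv : v.abv.IsNontrivial := by
  obtain ⟨π, hπ⟩ := IsDiscreteValuationRing.exists_irreducible v.1
  exact ⟨π, fun h ↦ hπ.ne_zero (Subtype.ext h), ((v.abv_coe_lt_one_iff π).mpr hπ.not_isUnit).ne⟩

variable {v w} in
lemma eq_of_isEquiv_abv (h : v.abv.IsEquiv w.abv) : v = w := by
  apply Subtype.ext
  ext x
  rw [← abv_le_one_iff, ← abv_le_one_iff]
  exact h.le_one_iff

lemma abv_injective : Function.Injective (abv : FunctionFieldPlace L → AbsoluteValue L ℝ) :=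
  fun _ _ h ↦ eq_of_isEquiv_abv (h ▸ AbsoluteValue.IsEquiv.refl _)

/-- Weak approximation at finitely many places. -/
lemma exists_forall_abv_sub_lt (T : Finset (FunctionFieldPlace L)) (a : T → L) {ε : ℝ}
    (hε : 0 < ε) : ∃ z : L, ∀ v : T, v.1.abv (z - a v) < ε := by
  have hd := AbsoluteValue.denseRange_algebraMap_pi (v := fun v : T ↦ v.1.abv)
    (fun v ↦ v.1.isNontrivial_abv)
    (fun _ _ hvw h ↦ hvw (Subtype.ext (eq_of_isEquiv_abv h)))
  obtain ⟨z, hz⟩ := Metric.denseRange_iff.mp hd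
    (fun v ↦ (WithAbs.equiv v.1.abv).symm (a v)) ε hε
  refine ⟨z, fun v ↦ ?_⟩
  have h := (dist_pi_lt_iff hε).mp hz v
  rw [dist_comm, dist_eq_norm] at h
  exact h

end FunctionFieldPlace

/-! ### The degree of the divisor of poles and the product formula -/

section PoleDivisor

open IntermediateField FunctionFieldPlace

variable {F L : Type*} [Field F] [Field L] [Algebra F L]

lemma adjoin_simple_inv (x : L) : F⟮x⁻¹⟯ = F⟮x⟯ := by
  apply le_antisymm
  · exact adjoin_simple_le_iff.mpr (inv_mem (mem_adjoin_simple_self F x))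
  · rw [adjoin_simple_le_iff]
    simpa using inv_mem (mem_adjoin_simple_self F x⁻¹)

lemma transcendental_inv {x : L} (hx : Transcendental F x) : Transcendental F x⁻¹ :=
  fun h ↦ hx (by simpa using h.inv)

variable [Finite F]

lemma FunctionFieldPlace.abv_eq_one_of_isAlgebraic (v : FunctionFieldPlace L) {x : L} (hx0 : x ≠ 0)
    (hx : IsAlgebraic F x) : v.abv x = 1 := by
  have key {y : L} (hy0 : y ≠ 0) (hy : IsAlgebraic F y) (hle : v.abv y ≤ 1) : v.abv y = 1 := by
    have hyv := (v.abv_le_one_iff y).mp hle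
    refine (v.abv_coe_eq_one_iff ⟨y, hyv⟩).mpr ?_
    by_contra hu
    exact v.1.transcendental_of_not_isUnit (F := F) (y := ⟨y, hyv⟩)
      (fun h ↦ hy0 (congrArg Subtype.val h)) hu hy
  rcases le_total (v.abv x) 1 with h | h
  · exact key hx0 hx h
  · have := key (inv_ne_zero hx0) hx.inv (by rw [map_inv₀]; exact inv_le_one_of_one_le₀ h)
    rwa [map_inv₀, inv_eq_one] at this

variable (hL : IsFunctionFieldInOneVariable F L)

include hL

lemma FunctionFieldPlace.exists_one_lt_abv {z : L} (hz : Transcendental F z) :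
    ∃ v : FunctionFieldPlace L, 1 < v.abv z := by
  obtain ⟨v, hv⟩ := exists_inv_mem_nonunits hL hz
  exact ⟨v, (v.one_lt_abv_iff_inv_mem_nonunits z).mpr ⟨fun h ↦ hz (h ▸ isAlgebraic_zero), hv⟩⟩

/-- The degree of a finite part of the divisor of poles of `x` is at most `[L : F(x)]`: by weak
approximation, `∏ A_v / x⁻¹ A_v` is a quotient of a ring of functions regular at the given
places. -/
lemma prod_abv_le {x : L} (hx : Transcendental F x) (T : Finset (FunctionFieldPlace L))
    (hT : ∀ v ∈ T, 1 < v.abv x) :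
    ∏ v ∈ T, v.abv x ≤ (Nat.card F : ℝ) ^ Module.finrank F⟮x⟯ L := by
  classical
  have hx0 : x ≠ 0 := fun h ↦ hx (h ▸ isAlgebraic_zero)
  have hylt (v : T) : v.1.abv x⁻¹ < 1 := by
    rw [map_inv₀]; exact inv_lt_one_of_one_lt₀ (hT v v.2)
  have hy (v : T) : x⁻¹ ∈ v.1.1 := (v.1.abv_le_one_iff _).mp (hylt v).le
  let y (v : T) : v.1.1 := ⟨x⁻¹, hy v⟩
  let R : Subalgebra F L := ⨅ v : T, v.1.1.toFiniteSubalgebra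
  have hR (z : L) : z ∈ R ↔ ∀ v : T, z ∈ v.1.1 := by
    simp only [R, Algebra.mem_iInf]; rfl
  let yR : R := ⟨x⁻¹, (hR _).mpr hy⟩
  let ρ (v : T) : R →+* v.1.1 :=
    { toFun := fun z ↦ ⟨z, (hR _).mp z.2 v⟩
      map_one' := rfl
      map_mul' := fun _ _ ↦ rfl
      map_zero' := rfl
      map_add' := fun _ _ ↦ rfl }
  let π : R →+* Π v : T, v.1.1 ⧸ Ideal.span {y v} :=
    RingHom.pi fun v ↦ (Ideal.Quotient.mk (Ideal.span {y v})).comp (ρ v)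
  have hπy : π yR = 0 := by
    ext v
    exact Ideal.Quotient.eq_zero_iff_mem.mpr (Ideal.mem_span_singleton_self (y v))
  have hπ : Function.Surjective π := by
    intro q
    choose a ha using fun v : T ↦ Ideal.Quotient.mk_surjective (q v)
    have hpos (v : FunctionFieldPlace L) : 0 < v.abv x⁻¹ := v.abv.pos (inv_ne_zero hx0)
    obtain ⟨z, hz⟩ := exists_forall_abv_sub_lt T (fun v ↦ (a v : L))
      (ε := ∏ v ∈ T, v.abv x⁻¹) (Finset.prod_pos fun v _ ↦ hpos v)
    have hdvd (v : T) : (z - a v) * x ∈ v.1.1 := by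
      rw [← v.1.abv_le_one_iff, map_mul]
      have h1 : ∏ w ∈ T, w.abv x⁻¹ ≤ v.1.abv x⁻¹ := by
        rw [← Finset.mul_prod_erase T _ v.2]
        refine mul_le_of_le_one_right (hpos _).le (Finset.prod_le_one (fun w _ ↦ (hpos w).le) ?_)
        exact fun w hw ↦ (hylt ⟨w, Finset.mem_of_mem_erase hw⟩).le
      have h2 := (hz v).le.trans h1
      rw [map_inv₀] at h2
      have h3 : 0 < v.1.abv x := v.1.abv.pos hx0
      calc v.1.abv (z - a v) * v.1.abv x ≤ (v.1.abv x)⁻¹ * v.1.abv x := by gcongr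
        _ = 1 := inv_mul_cancel₀ h3.ne'
    have hz' (v : T) : z = a v + x⁻¹ * ((z - a v) * x) := by
      field_simp; ring
    have hzR : z ∈ R := (hR z).mpr fun v ↦ by
      rw [hz' v]
      exact add_mem (a v).2 (mul_mem (hy v) (hdvd v))
    refine ⟨⟨z, hzR⟩, ?_⟩
    ext v
    rw [← ha v]
    refine Ideal.Quotient.eq.mpr (Ideal.mem_span_singleton.mpr ⟨⟨_, hdvd v⟩, Subtype.ext ?_⟩)
    change z - a v = x⁻¹ * ((z - a v) * x)
    field_simp
  have hxinv := transcendental_inv hx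
  have := hL.finiteDimensional_adjoin _ hxinv
  have hcard := (finite_and_card_le_of_surjective (y := yR) hxinv π hπ hπy).2
  have h1 : ((Nat.card (Π v : T, v.1.1 ⧸ Ideal.span {y v}) : ℕ) : ℝ) = ∏ v ∈ T, v.abv x := by
    rw [Nat.card_pi, Nat.cast_prod, ← Finset.prod_coe_sort T (fun v ↦ v.abv x)]
    refine Finset.prod_congr rfl fun v _ ↦ ?_
    rw [v.1.card_quotient_span_singleton (fun h ↦ inv_ne_zero hx0 (congrArg Subtype.val h)),
      map_inv₀, inv_inv]
  rw [← h1, ← adjoin_simple_inv]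
  exact_mod_cast hcard

omit hL in
/-- At a pole `v` of `x`, `|x|_v` is an integer greater than one. -/
lemma FunctionFieldPlace.two_le_abv (v : FunctionFieldPlace L) {x : L} (hx : 1 < v.abv x) :
    2 ≤ v.abv x := by
  have hx0 : x ≠ 0 := by rintro rfl; norm_num at hx
  have h1 : v.abv x⁻¹ ≤ 1 := by rw [map_inv₀]; exact (inv_lt_one_of_one_lt₀ hx).le
  have h2 := v.card_quotient_span_singleton (y := ⟨x⁻¹, (v.abv_le_one_iff _).mp h1⟩)
    (fun h ↦ inv_ne_zero hx0 (congrArg Subtype.val h))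
  have h3 : (v.abv x⁻¹)⁻¹ = v.abv x := by rw [map_inv₀, inv_inv]
  rw [← h2.trans h3] at hx ⊢
  exact_mod_cast hx

lemma finite_poles (x : L) : {v : FunctionFieldPlace L | 1 < v.abv x}.Finite := by
  by_cases hx : IsAlgebraic F x
  · convert! Set.finite_empty
    ext v
    simp only [Set.mem_ofPred_eq, Set.mem_empty_iff_false, iff_false, not_lt]
    by_cases hx0 : x = 0
    · simp [hx0]
    · exact (v.abv_eq_one_of_isAlgebraic hx0 hx).le
  · by_contra hinf
    obtain ⟨n, hn⟩ := pow_unbounded_of_one_lt ((Nat.card F : ℝ) ^ Module.finrank F⟮x⟯ L)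
      one_lt_two
    obtain ⟨T, hT, hTn⟩ := Set.Infinite.exists_subset_card_eq hinf n
    have h1 := prod_abv_le hL hx T fun v hv ↦ hT hv
    have h2 : (2 : ℝ) ^ n ≤ ∏ v ∈ T, v.abv x := by
      rw [← hTn, ← Finset.prod_const]
      exact Finset.prod_le_prod (fun _ _ ↦ zero_le_two) fun v hv ↦ v.two_le_abv (hT hv)
    linarith

lemma finite_abv_ne_one {x : L} (hx : x ≠ 0) :
    {v : FunctionFieldPlace L | v.abv x ≠ 1}.Finite := by
  refine ((finite_poles hL x).union (finite_poles hL x⁻¹)).subset fun v hv ↦ ?_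
  rcases lt_or_gt_of_ne hv with h | h
  · right
    change 1 < v.abv x⁻¹
    rw [map_inv₀]
    exact one_lt_inv₀ (v.abv.pos hx) |>.mpr h
  · exact Or.inl h

omit [Finite F] hL in
variable (L) in
/-- The constants of a function field: the functions without poles. -/
def functionFieldConstants : Set L := {z | ∀ v : FunctionFieldPlace L, v.abv z ≤ 1}

/-- The constants embed into `A_v / t A_v`, for any zero `v` of `t`. -/
lemma finite_constants_and_card_le {t : L} (ht : Transcendental F t) :
    (functionFieldConstants L).Finite ∧
      Nat.card (functionFieldConstants L) ≤ Nat.card F ^ Module.finrank F⟮t⟯ L := by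
  have ht0 : t ≠ 0 := fun h ↦ ht (h ▸ isAlgebraic_zero)
  obtain ⟨v, hv⟩ := exists_one_lt_abv hL (transcendental_inv ht)
  have htlt : v.abv t < 1 := by
    rw [map_inv₀] at hv
    exact (one_lt_inv₀ (v.abv.pos ht0)).mp hv
  let y : v.1 := ⟨t, (v.abv_le_one_iff t).mp htlt.le⟩
  obtain ⟨hfin, hcard⟩ := v.1.finite_quotient_and_card_le hL (y := y) ht
  let f (z : functionFieldConstants L) : v.1 ⧸ Ideal.span {y} :=
    Ideal.Quotient.mk _ ⟨z, (v.abv_le_one_iff _).mp (z.2 v)⟩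
  have hf : Function.Injective f := by
    intro z w h
    obtain ⟨r, hr⟩ := Ideal.mem_span_singleton.mp (Ideal.Quotient.eq.mp h)
    have hr' : (z : L) - w = t * r := congrArg Subtype.val hr
    by_contra hne
    have hne' : (z : L) - w ≠ 0 := fun h ↦ hne (Subtype.ext (sub_eq_zero.mp h))
    have halg : IsAlgebraic F ((z : L) - w) := by
      by_contra htr
      obtain ⟨u, hu⟩ := exists_one_lt_abv hL htr
      refine absurd hu (not_lt.mpr ?_)
      rw [sub_eq_add_neg]
      refine (u.isNonarchimedean_abv _ _).trans (max_le (z.2 u) ?_)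
      rw [AbsoluteValue.map_neg]
      exact w.2 u
    have h1 := v.abv_eq_one_of_isAlgebraic hne' halg
    rw [hr', map_mul] at h1
    have h2 : v.abv t * v.abv (r : L) < 1 :=
      mul_lt_one_of_nonneg_of_lt_one_left (v.abv.nonneg _) htlt (v.abv_coe_le_one r)
    exact h2.ne h1
  have := Finite.of_injective f hf
  refine ⟨Set.toFinite _, (Nat.card_le_card_of_injective f hf).trans hcard⟩

end PoleDivisor

/-! ### Counting in Riemann–Roch spaces -/

section Counting

open IntermediateField FunctionFieldPlace

variable {F L : Type*} [Field F] [Field L] [Algebra F L]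

/-- A weak form of the Riemann inequality, by the pigeonhole principle: functions with poles
bounded by `c` are determined up to a constant by their principal parts, of which there are
`∏ |c_v|_v`. -/
lemma exists_ne_zero_map_eq_zero_of_abv_le (hE : (functionFieldConstants L).Finite) {X : Type*}
    [AddCommGroup X] (g : X →+ L) (T : Finset (FunctionFieldPlace L))
    (c : FunctionFieldPlace L → L) (hc : ∀ v ∈ T, 1 ≤ v.abv (c v))
    (hg : ∀ v ∈ T, ∀ a, v.abv (g a) ≤ v.abv (c v)) (hg' : ∀ v ∉ T, ∀ a, v.abv (g a) ≤ 1)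
    (hcard : Nat.card (functionFieldConstants L) * ∏ v ∈ T, v.abv (c v) < Nat.card X) :
    ∃ a ≠ 0, g a = 0 := by
  classical
  by_contra! hinj
  have hc0 (v : T) : c v ≠ 0 := fun h ↦ by
    have := hc v v.2
    rw [h, map_zero] at this
    norm_num at this
  have hmem (v : T) : (c v)⁻¹ ∈ v.1.1 := by
    rw [← abv_le_one_iff, map_inv₀]
    exact inv_le_one_of_one_le₀ (hc v v.2)
  have hgmem (v : T) (a : X) : g a * (c v)⁻¹ ∈ v.1.1 := by
    rw [← abv_le_one_iff, map_mul, map_inv₀]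
    exact mul_inv_le_one_of_le₀ (hg v v.2 a) (v.1.abv.nonneg _)
  let y (v : T) : v.1.1 := ⟨(c v)⁻¹, hmem v⟩
  let f (a : X) (v : T) : v.1.1 ⧸ Ideal.span {y v} := Ideal.Quotient.mk _ ⟨_, hgmem v a⟩
  have hf {a b : X} (hab : f a = f b) : g (a - b) ∈ functionFieldConstants L := by
    intro v
    by_cases hv : v ∈ T
    · obtain ⟨r, hr⟩ := Ideal.mem_span_singleton.mp (Ideal.Quotient.eq.mp (congrFun hab ⟨v, hv⟩))
      have hr' : g a * (c v)⁻¹ - g b * (c v)⁻¹ = (c v)⁻¹ * r := congrArg Subtype.val hr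
      have h1 : g (a - b) = r := by
        have := hc0 ⟨v, hv⟩
        rw [map_sub]
        field_simp at hr'
        exact hr'
      rw [h1]
      exact v.abv_coe_le_one r
    · exact hg' v hv _
  have hq (v : T) : (Nat.card (v.1.1 ⧸ Ideal.span {y v}) : ℝ) = v.1.abv (c v) := by
    rw [v.1.card_quotient_span_singleton (fun h ↦ inv_ne_zero (hc0 v) (congrArg Subtype.val h)),
      map_inv₀, inv_inv]
  have hqfin (v : T) : Finite (v.1.1 ⧸ Ideal.span {y v}) := by
    apply Nat.finite_of_card_ne_zero
    intro h
    have h1 := hq v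
    rw [h, Nat.cast_zero] at h1
    have := hc v v.2
    linarith
  have : Finite (functionFieldConstants L) := hE
  -- An element is determined by its principal parts and by its difference, which is a constant,
  -- from a chosen element with the same principal parts.
  let e (a : X) : functionFieldConstants L × (Π v : T, v.1.1 ⧸ Ideal.span {y v}) :=
    ⟨⟨g (a - Function.invFun f (f a)), hf (Function.invFun_eq ⟨a, rfl⟩).symm⟩, f a⟩
  have he : Function.Injective e := by
    intro a b hab
    have h1 : f a = f b := congrArg Prod.snd hab
    have h2 : g (a - Function.invFun f (f a)) = g (b - Function.invFun f (f b)) :=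
      congrArg Subtype.val (congrArg Prod.fst hab)
    rw [h1, ← sub_eq_zero, ← map_sub, sub_sub_sub_cancel_right] at h2
    by_contra hne
    exact hinj _ (sub_ne_zero.mpr hne) h2
  refine absurd hcard (not_lt.mpr ?_)
  have h1 : ((Nat.card (Π v : T, v.1.1 ⧸ Ideal.span {y v}) : ℕ) : ℝ) = ∏ v ∈ T, v.abv (c v) := by
    rw [Nat.card_pi, Nat.cast_prod, ← Finset.prod_coe_sort T (fun v ↦ v.abv (c v))]
    exact Finset.prod_congr rfl fun v _ ↦ hq v
  rw [← h1, ← Nat.cast_mul, ← Nat.card_prod]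
  exact_mod_cast Nat.card_le_card_of_injective e he

lemma FunctionFieldPlace.abv_sum_le (v : FunctionFieldPlace L) {ι : Type*} (s : Finset ι)
    (f : ι → L) {C : ℝ} (hC : 0 ≤ C) (hf : ∀ i ∈ s, v.abv (f i) ≤ C) :
    v.abv (∑ i ∈ s, f i) ≤ C :=
  Finset.sum_induction f (fun y ↦ v.abv y ≤ C)
    (fun a b ha hb ↦ (v.isNonarchimedean_abv a b).trans (max_le ha hb)) (by simpa using hC) hf

lemma linearIndependent_pow_mul_of_transcendental {x : L} (hx : Transcendental F x) {ι : Type*}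
    {u : ι → L} (hu : LinearIndependent F⟮x⟯ u) (l : ℕ) :
    LinearIndependent F fun p : Fin l × ι ↦ x ^ (p.1 : ℕ) * u p.2 := by
  have hx' : Transcendental F (AdjoinSimple.gen F x) := fun h ↦
    hx (by simpa using h.algebraMap (A := L))
  have h1 : LinearIndependent F fun i : ℕ ↦ AdjoinSimple.gen F x ^ i := by
    have h2 := (Polynomial.basisMonomials F).linearIndependent.map'
      (Polynomial.aeval (AdjoinSimple.gen F x)).toLinearMap
      (LinearMap.ker_eq_bot.mpr (transcendental_iff_injective.mp hx'))
    have h3 : (Polynomial.aeval (AdjoinSimple.gen F x)).toLinearMap ∘ Polynomial.basisMonomials F =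
        fun i : ℕ ↦ AdjoinSimple.gen F x ^ i := by
      ext i
      simp
    exact h3 ▸ h2
  have h3 := linearIndependent_smul (h1.comp (fun i : Fin l ↦ (i : ℕ)) Fin.val_injective) hu
  exact h3

/-- An inequality up to a constant factor between all powers is an inequality. -/
lemma le_of_forall_pow_succ_le_mul_pow {q P C : ℝ} (hP : 1 ≤ P)
    (h : ∀ l : ℕ, q ^ (l + 1) ≤ C * P ^ l) : q ≤ P := by
  by_contra! hlt
  have hP0 : 0 < P := by linarith
  have hq0 : 0 < q := by linarith
  obtain ⟨l, hl⟩ := pow_unbounded_of_one_lt (C / q) ((one_lt_div hP0).mpr hlt)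
  have h1 := h l
  rw [div_pow, div_lt_div_iff₀ hq0 (by positivity), ← pow_succ] at hl
  linarith

variable [Finite F]

lemma FunctionFieldPlace.abv_smul_le (v : FunctionFieldPlace L) (a : F) (z : L) :
    v.abv (a • z) ≤ v.abv z := by
  rw [Algebra.smul_def, map_mul]
  refine mul_le_of_le_one_left (v.abv.nonneg _) ?_
  exact (v.abv_le_one_iff _).mpr (v.1.algebraMap_mem_of_finite a)

/-- The counting argument for a linear system: the family `f` has at most
`dim E + deg D` independent members, for the constants `E` and a divisor `D` bounding its poles. -/
lemma card_pow_le_of_linearIndependent (hE : (functionFieldConstants L).Finite) {ι : Type*}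
    [Fintype ι] {f : ι → L} (hf : LinearIndependent F f) (T : Finset (FunctionFieldPlace L))
    (c : FunctionFieldPlace L → L) (hc : ∀ v ∈ T, 1 ≤ v.abv (c v))
    (hg : ∀ v ∈ T, ∀ i, v.abv (f i) ≤ v.abv (c v)) (hg' : ∀ v ∉ T, ∀ i, v.abv (f i) ≤ 1) :
    (Nat.card F : ℝ) ^ Fintype.card ι ≤
      Nat.card (functionFieldConstants L) * ∏ v ∈ T, v.abv (c v) := by
  by_contra! hlt
  obtain ⟨a, ha0, ha⟩ := exists_ne_zero_map_eq_zero_of_abv_le hE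
    (Fintype.linearCombination F f).toAddMonoidHom T c hc
    (fun v hv a ↦ v.abv_sum_le _ _ (v.abv.nonneg _)
      fun i _ ↦ (v.abv_smul_le _ _).trans (hg v hv i))
    (fun v hv a ↦ v.abv_sum_le _ _ zero_le_one fun i _ ↦ (v.abv_smul_le _ _).trans (hg' v hv i))
    (by rw [Nat.card_fun, Nat.card_eq_fintype_card (α := ι)]; exact_mod_cast hlt)
  exact ha0 (funext (Fintype.linearIndependent_iff.mp hf a ha))

variable (hL : IsFunctionFieldInOneVariable F L)

include hL

omit [Finite F] [Algebra F L] hL in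
lemma finprod_max_abv_one_eq_prod {x : L} {T : Finset (FunctionFieldPlace L)}
    (hT : ∀ v ∉ T, v.abv x ≤ 1) :
    ∏ᶠ v : FunctionFieldPlace L, max (v.abv x) 1 = ∏ v ∈ T, max (v.abv x) 1 :=
  finprod_eq_prod_of_mulSupport_subset _ fun v hv ↦ by
    by_contra hvT
    exact hv (max_eq_right (hT v hvT))

omit [Finite F] [Algebra F L] hL in
lemma FunctionFieldPlace.exists_abv_eq_max (v : FunctionFieldPlace L) (x : L) :
    ∃ X, v.abv X = max (v.abv x) 1 := by
  rcases le_total (v.abv x) 1 with h | h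
  · exact ⟨1, by rw [map_one, max_eq_right h]⟩
  · exact ⟨x, (max_eq_left h).symm⟩

/-- The degree of the divisor of poles of `x` is `[L : F(x)]`. -/
theorem finprod_max_abv_one_of_transcendental {x : L} (hx : Transcendental F x) :
    ∏ᶠ v : FunctionFieldPlace L, max (v.abv x) 1 =
      (Nat.card F : ℝ) ^ Module.finrank F⟮x⟯ L := by
  classical
  have hpos (v : FunctionFieldPlace L) : 1 ≤ max (v.abv x) 1 := le_max_right _ _
  have := hL.finiteDimensional_adjoin x hx
  let u := Module.finBasis F⟮x⟯ L
  have hE := (finite_constants_and_card_le hL hx).1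
  have hfin := (finite_poles hL x).union (Set.finite_iUnion fun j ↦ finite_poles hL (u j))
  set T := hfin.toFinset with hT
  have hTx {v : FunctionFieldPlace L} (hv : v ∉ T) : v.abv x ≤ 1 := by
    simp only [hT, Set.Finite.mem_toFinset, Set.mem_union, not_or] at hv
    exact not_lt.mp hv.1
  have hTu {v : FunctionFieldPlace L} (hv : v ∉ T) j : v.abv (u j) ≤ 1 := by
    simp only [hT, Set.Finite.mem_toFinset, Set.mem_union, not_or, Set.mem_iUnion,
      not_exists] at hv
    exact not_lt.mp (hv.2 j)
  rw [finprod_max_abv_one_eq_prod fun v ↦ hTx]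
  apply le_antisymm
  · refine le_trans (le_of_eq ?_) (prod_abv_le hL hx {v ∈ T | 1 < v.abv x}
      fun v hv ↦ (Finset.mem_filter.mp hv).2)
    rw [Finset.prod_filter]
    refine Finset.prod_congr rfl fun v _ ↦ ?_
    split_ifs with h
    · exact max_eq_left h.le
    · exact max_eq_right (not_lt.mp h)
  -- Count the functions `∑ P_j(x) u_j` with `deg P_j ≤ l`, and let `l` tend to infinity.
  · have hm (v : FunctionFieldPlace L) : ∃ m, 1 ≤ v.abv m ∧ ∀ j, v.abv (u j) ≤ v.abv m := by
      obtain ⟨i, hi⟩ := Finite.exists_max fun i : Option (Fin _) ↦ v.abv (i.elim 1 u)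
      exact ⟨_, by simpa using hi none, fun j ↦ hi (some j)⟩
    choose m hm1 hm using hm
    choose X hX using fun v : FunctionFieldPlace L ↦ v.exists_abv_eq_max x
    refine le_of_forall_pow_succ_le_mul_pow
      (C := Nat.card (functionFieldConstants L) * ∏ v ∈ T, v.abv (m v)) ?_ fun l ↦ ?_
    · exact Finset.one_le_prod fun v _ ↦ hpos v
    · have key := card_pow_le_of_linearIndependent hE
        (linearIndependent_pow_mul_of_transcendental hx u.linearIndependent (l + 1)) T
        (fun v ↦ X v ^ l * m v) (fun v _ ↦ ?_) (fun v _ p ↦ ?_) (fun v hv p ↦ ?_)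
      · rw [Fintype.card_prod, Fintype.card_fin, Fintype.card_fin, mul_comm, pow_mul] at key
        refine key.trans_eq ?_
        simp only [map_mul, map_pow, hX, Finset.prod_mul_distrib, Finset.prod_pow]
        ring
      · rw [map_mul, map_pow, hX]
        exact one_le_mul_of_one_le_of_one_le (one_le_pow₀ (hpos v)) (hm1 v)
      · rw [map_mul, map_pow, map_mul, map_pow, hX]
        refine mul_le_mul ?_ (hm v _) (v.abv.nonneg _) (pow_nonneg (zero_le_one.trans (hpos v)) _)
        exact (pow_le_pow_left₀ (v.abv.nonneg _) (le_max_left _ _) _).trans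
          (pow_le_pow_right₀ (hpos v) (Nat.lt_succ_iff.mp p.1.2))
      · rw [map_mul, map_pow]
        exact mul_le_one₀ (pow_le_one₀ (v.abv.nonneg _) (hTx hv)) (v.abv.nonneg _) (hTu hv _)

omit hL in
lemma finprod_max_abv_one_of_isAlgebraic {x : L} (hx : IsAlgebraic F x) :
    ∏ᶠ v : FunctionFieldPlace L, max (v.abv x) 1 = 1 := by
  refine finprod_eq_one_of_forall_eq_one fun v ↦ ?_
  by_cases hx0 : x = 0
  · simp [hx0]
  · rw [v.abv_eq_one_of_isAlgebraic hx0 hx, max_self]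

end Counting

/-! ### The height on a function field -/

section Height

open IntermediateField FunctionFieldPlace

variable {F L : Type*} [Field F] [Field L] [Algebra F L] [Finite F]

lemma max_one_eq_mul_max_inv_one {a : ℝ} (ha : 0 < a) : max a 1 = a * max a⁻¹ 1 := by
  rw [mul_max_of_nonneg _ _ ha.le, mul_inv_cancel₀ ha.ne', mul_one, max_comm]

/-- The product formula: `F(x) = F(x⁻¹)`, so `x` has as many zeros as poles. -/
theorem finprod_abv_eq_one (hL : IsFunctionFieldInOneVariable F L) {x : L} (hx : x ≠ 0) :
    ∏ᶠ v : FunctionFieldPlace L, v.abv x = 1 := by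
  have h1 : ∏ᶠ v : FunctionFieldPlace L, max (v.abv x) 1 =
      ∏ᶠ v : FunctionFieldPlace L, max (v.abv x⁻¹) 1 := by
    by_cases hx' : IsAlgebraic F x
    · rw [finprod_max_abv_one_of_isAlgebraic hx', finprod_max_abv_one_of_isAlgebraic hx'.inv]
    · rw [finprod_max_abv_one_of_transcendental hL hx',
        finprod_max_abv_one_of_transcendental hL (transcendental_inv hx'), adjoin_simple_inv]
  have hs (x : L) :
      (Function.mulSupport fun v : FunctionFieldPlace L ↦ max (v.abv x) 1).Finite := by
    refine (finite_poles hL x).subset fun v hv ↦ ?_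
    by_contra h
    exact hv (max_eq_right (not_lt.mp h))
  have h2 : ∏ᶠ v : FunctionFieldPlace L, max (v.abv x) 1 =
      (∏ᶠ v : FunctionFieldPlace L, v.abv x) *
        ∏ᶠ v : FunctionFieldPlace L, max (v.abv x⁻¹) 1 := by
    rw [← finprod_mul_distrib (finite_abv_ne_one hL hx) (hs _)]
    refine finprod_congr fun v ↦ ?_
    rw [map_inv₀]
    exact max_one_eq_mul_max_inv_one (v.abv.pos hx)
  have h3 : (0 : ℝ) < ∏ᶠ v : FunctionFieldPlace L, max (v.abv x⁻¹) 1 :=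
    finprod_induction (0 < ·) zero_lt_one (fun _ _ ↦ mul_pos)
      fun v ↦ zero_lt_one.trans_le (le_max_right _ _)
  rw [h1] at h2
  exact (mul_right_cancel₀ h3.ne' ((one_mul _).trans h2)).symm

/-- The places of a function field satisfy the product formula. -/
noncomputable abbrev FunctionFieldPlace.admissibleAbsValues
    (hL : IsFunctionFieldInOneVariable F L) : Height.AdmissibleAbsValues L where
  archAbsVal := 0
  nonarchAbsVal := Set.range abv
  isNonarchimedean := by
    rintro _ ⟨v, rfl⟩
    exact v.isNonarchimedean_abv
  hasFiniteMulSupport {x} hx := by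
    refine Set.Finite.subset ((finite_abv_ne_one hL hx).image (Set.rangeFactorization abv)) ?_
    rintro ⟨_, v, rfl⟩ hv
    exact ⟨v, hv, rfl⟩
  product_formula {x} hx := by
    rw [Multiset.map_zero, Multiset.prod_zero, one_mul, ← finprod_abv_eq_one hL hx]
    exact (finprod_eq_of_bijective _ (Equiv.ofInjective abv abv_injective).bijective
      fun _ ↦ rfl).symm

open Height in
lemma FunctionFieldPlace.logHeight₁_eq_log_finprod (hL : IsFunctionFieldInOneVariable F L) (x : L) :
    letI := admissibleAbsValues hL
    logHeight₁ x = Real.log (∏ᶠ v : FunctionFieldPlace L, max (v.abv x) 1) := by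
  let _ := admissibleAbsValues hL
  rw [logHeight₁_eq_log_mulHeight₁, mulHeight₁_eq]
  congr 1
  have h1 : (AdmissibleAbsValues.archAbsVal (K := L)) = 0 := rfl
  rw [h1, Multiset.map_zero, Multiset.prod_zero, one_mul]
  exact (finprod_eq_of_bijective _ (Equiv.ofInjective abv abv_injective).bijective
    fun _ ↦ rfl).symm

end Height

/-! ### Heights over function fields with finite constant fields -/

section FunctionField

open IntermediateField FunctionFieldPlace

open scoped RatFunc

lemma FunctionField.isFunctionFieldInOneVariable (F L : Type*) [Field F] [Field L]
    [Algebra F⟮X⟯ L] [FunctionField F L] [Algebra F L] [IsScalarTower F F⟮X⟯ L] :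
    IsFunctionFieldInOneVariable F L where
  exists_transcendental := ⟨algebraMap F⟮X⟯ L RatFunc.X,
    (transcendental_algebraMap_iff (algebraMap F⟮X⟯ L).injective).mpr RatFunc.transcendental_X⟩
  finiteDimensional_adjoin _ := FunctionField.finiteDimensional_of_adjoin_transcendental

variable {F M L : Type*} [Field F] [Field M] [Field L] [Algebra F M] [Algebra F L] [Algebra M L]
  [IsScalarTower F M L]

lemma finrank_map_toAlgHom (E : IntermediateField F M) :
    Module.finrank (E.map (IsScalarTower.toAlgHom F M L)) L =
      Module.finrank E M * Module.finrank M L := by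
  rw [Module.finrank_mul_finrank E M L]
  refine (Algebra.finrank_eq_of_equiv_equiv
    (E.equivMap (IsScalarTower.toAlgHom F M L)).toRingEquiv (RingEquiv.refl L) ?_).symm
  ext z
  rfl

lemma finrank_adjoin_simple_algebraMap (z : M) :
    Module.finrank F⟮algebraMap M L z⟯ L = Module.finrank F⟮z⟯ M * Module.finrank M L := by
  have h := finrank_map_toAlgHom (L := L) F⟮z⟯
  rwa [adjoin_map, Set.image_singleton] at h

/-- The relative height is multiplied by the degree in a finite extension. -/
lemma finprod_max_abv_one_algebraMap [Finite F] (hM : IsFunctionFieldInOneVariable F M)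
    (hL : IsFunctionFieldInOneVariable F L) (z : M) :
    ∏ᶠ v : FunctionFieldPlace L, max (v.abv (algebraMap M L z)) 1 =
      (∏ᶠ v : FunctionFieldPlace M, max (v.abv z) 1) ^ Module.finrank M L := by
  by_cases hz : IsAlgebraic F z
  · rw [finprod_max_abv_one_of_isAlgebraic hz, finprod_max_abv_one_of_isAlgebraic hz.algebraMap,
      one_pow]
  · rw [finprod_max_abv_one_of_transcendental hM hz, finprod_max_abv_one_of_transcendental hL
      ((transcendental_algebraMap_iff (algebraMap M L).injective).mpr hz),
      finrank_adjoin_simple_algebraMap, pow_mul]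

lemma finsum_posLog_abv [Finite F] (hL : IsFunctionFieldInOneVariable F L) (x : L) :
    ∑ᶠ v : FunctionFieldPlace L, Real.posLog (v.abv x) =
      Real.log (∏ᶠ v : FunctionFieldPlace L, max (v.abv x) 1) := by
  have hT (v) (hv : v ∉ (finite_poles hL x).toFinset) : v.abv x ≤ 1 := by
    simpa using hv
  rw [finprod_max_abv_one_eq_prod hT,
    Real.log_prod fun v _ ↦ (zero_lt_one.trans_le (le_max_right _ _)).ne',
    finsum_eq_sum_of_support_subset (s := (finite_poles hL x).toFinset)]
  · refine Finset.sum_congr rfl fun v _ ↦ ?_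
    rw [Real.posLog_eq_log_max_one (v.abv.nonneg _), max_comm]
  · intro v hv
    by_contra h
    refine hv (Real.posLog_eq_zero_iff _ |>.mpr ?_)
    rw [abs_of_nonneg (v.abv.nonneg _)]
    exact hT v h

variable (F) {K : Type*} [Finite F] [Field K] [Algebra F⟮X⟯ K] [FunctionField F K]
  [Algebra F K] [IsScalarTower F F⟮X⟯ K]

omit [Finite F] in
lemma IntermediateField.isFunctionFieldInOneVariable {Ω : Type*} [Field Ω] [Algebra K Ω]
    [Algebra F Ω] [IsScalarTower F K Ω]
    (L : IntermediateField K Ω) [FiniteDimensional K L] : IsFunctionFieldInOneVariable F L := by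
  let _ : Algebra F⟮X⟯ L := ((algebraMap K L).comp (algebraMap F⟮X⟯ K)).toAlgebra
  have : IsScalarTower F⟮X⟯ K L := IsScalarTower.of_algebraMap_eq fun _ ↦ rfl
  have : IsScalarTower F F⟮X⟯ L := IsScalarTower.of_algebraMap_eq fun a ↦ by
    rw [IsScalarTower.algebraMap_apply F⟮X⟯ K L, ← IsScalarTower.algebraMap_apply F F⟮X⟯ K,
      ← IsScalarTower.algebraMap_apply F K L]
  have : FunctionField F L := Module.Finite.trans K L
  exact FunctionField.isFunctionFieldInOneVariable F L

include F in
lemma affineWeilHeight_eq_log_finprod (hK : ¬ CharZero K) (x : AlgebraicClosure K) :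
    affineWeilHeight K x = Real.log (∏ᶠ v : FunctionFieldPlace K⟮x⟯,
      max (v.abv (AdjoinSimple.gen K x)) 1) / Module.finrank K K⟮x⟯ := by
  have := adjoin.finiteDimensional (K := K) (Algebra.IsIntegral.isIntegral x)
  rw [affineWeilHeight, dif_neg hK, finsum_posLog_abv (K⟮x⟯.isFunctionFieldInOneVariable F)]

include F in
lemma log_finprod_eq_finrank_mul_affineWeilHeight (hK : ¬ CharZero K)
    (L : IntermediateField K (AlgebraicClosure K)) [FiniteDimensional K L] (x : L) :
    Real.log (∏ᶠ v : FunctionFieldPlace L, max (v.abv x) 1) =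
      Module.finrank K L * affineWeilHeight K x := by
  have hx : K⟮(x : AlgebraicClosure K)⟯ ≤ L := adjoin_simple_le_iff.mpr x.2
  let _ : Algebra K⟮(x : AlgebraicClosure K)⟯ L := (inclusion hx).toRingHom.toAlgebra
  have : IsScalarTower K K⟮(x : AlgebraicClosure K)⟯ L :=
    IsScalarTower.of_algebraMap_eq fun _ ↦ rfl
  have : IsScalarTower F K⟮(x : AlgebraicClosure K)⟯ L :=
    IsScalarTower.of_algebraMap_eq fun _ ↦ rfl
  have := adjoin.finiteDimensional (K := K) (Algebra.IsIntegral.isIntegral (x : AlgebraicClosure K))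
  have h1 := finprod_max_abv_one_algebraMap (L := L)
    (K⟮(x : AlgebraicClosure K)⟯.isFunctionFieldInOneVariable F)
    (L.isFunctionFieldInOneVariable F) (AdjoinSimple.gen K (x : AlgebraicClosure K))
  have h2 : algebraMap K⟮(x : AlgebraicClosure K)⟯ L
      (AdjoinSimple.gen K (x : AlgebraicClosure K)) = x := rfl
  have h3 : Module.finrank K K⟮(x : AlgebraicClosure K)⟯ ≠ 0 := Module.finrank_pos.ne'
  rw [h2] at h1
  rw [h1, Real.log_pow, affineWeilHeight_eq_log_finprod F hK,
    ← Module.finrank_mul_finrank K K⟮(x : AlgebraicClosure K)⟯ L]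
  push_cast
  field_simp

include F in
theorem isAbsoluteWeilHeight_affineWeilHeight_of_functionField (hK : ¬ CharZero K) :
    IsAbsoluteWeilHeight (affineWeilHeight K) where
  exists_field := by
    refine ⟨0, fun T hT ↦ ⟨adjoin K T, ?_⟩⟩
    have := hT.to_subtype
    have : FiniteDimensional K (adjoin K T) :=
      finiteDimensional_adjoin fun x _ ↦ Algebra.IsIntegral.isIntegral x
    have hL := (adjoin K T).isFunctionFieldInOneVariable F
    refine ⟨admissibleAbsValues hL, Module.finrank K (adjoin K T),
      Nat.cast_pos.mpr Module.finrank_pos, subset_adjoin K T, ?_, fun x ↦ ?_⟩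
    · rw [zero_mul]
      exact le_of_eq (Nat.cast_eq_zero.mpr Multiset.card_zero)
    · rw [logHeight₁_eq_log_finprod hL]
      exact log_finprod_eq_finrank_mul_affineWeilHeight F hK _ x

variable {F} in
/-- Two functions satisfy a polynomial relation the degrees of which are bounded in terms of the
degrees of their divisors of poles. -/
lemma exists_relation_of_finprod_le (hL : IsFunctionFieldInOneVariable F L) {t x : L}
    (ht : Transcendental F t) {A B : ℕ} (hA : Module.finrank F⟮t⟯ L ≤ A)
    (hB : ∏ᶠ v : FunctionFieldPlace L, max (v.abv x) 1 ≤ (Nat.card F : ℝ) ^ B) :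
    ∃ P : Fin (2 * B + 1) × Fin (2 * A + 1) → F, P ≠ 0 ∧
      ∑ p, P p • (t ^ (p.1 : ℕ) * x ^ (p.2 : ℕ)) = 0 := by
  classical
  by_contra! hP
  have hli : LinearIndependent F
      fun p : Fin (2 * B + 1) × Fin (2 * A + 1) ↦ t ^ (p.1 : ℕ) * x ^ (p.2 : ℕ) := by
    refine Fintype.linearIndependent_iff.mpr fun P h ↦ ?_
    by_contra! hne
    obtain ⟨i, hi⟩ := hne
    exact hP P (fun h0 ↦ hi (congrFun h0 i)) h
  have hq : 1 < (Nat.card F : ℝ) := by exact_mod_cast Finite.one_lt_card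
  have hA' : ∏ᶠ v : FunctionFieldPlace L, max (v.abv t) 1 ≤ (Nat.card F : ℝ) ^ A := by
    rw [finprod_max_abv_one_of_transcendental hL ht]
    exact pow_le_pow_right₀ hq.le hA
  obtain ⟨hE, hcE⟩ := finite_constants_and_card_le hL ht
  set T := ((finite_poles hL t).union (finite_poles hL x)).toFinset with hT
  have hTt {v : FunctionFieldPlace L} (hv : v ∉ T) : v.abv t ≤ 1 := by
    simp only [hT, Set.Finite.mem_toFinset, Set.mem_union, not_or] at hv
    exact not_lt.mp hv.1
  have hTx {v : FunctionFieldPlace L} (hv : v ∉ T) : v.abv x ≤ 1 := by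
    simp only [hT, Set.Finite.mem_toFinset, Set.mem_union, not_or] at hv
    exact not_lt.mp hv.2
  have h1 (v : FunctionFieldPlace L) (y : L) : 1 ≤ max (v.abv y) 1 := le_max_right _ _
  have hle (v : FunctionFieldPlace L) (y : L) {m n : ℕ} (h : m < n + 1) :
      v.abv y ^ m ≤ max (v.abv y) 1 ^ n :=
    (pow_le_pow_left₀ (v.abv.nonneg _) (le_max_left _ _) _).trans
      (pow_le_pow_right₀ (h1 v y) (Nat.lt_succ_iff.mp h))
  choose X hX using fun (v : FunctionFieldPlace L) y ↦ v.exists_abv_eq_max y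
  have key := card_pow_le_of_linearIndependent hE hli T
    (fun v ↦ X v t ^ (2 * B) * X v x ^ (2 * A)) (fun v _ ↦ ?_) (fun v _ p ↦ ?_)
    (fun v hv p ↦ ?_)
  · simp only [map_mul, map_pow, hX, Finset.prod_mul_distrib, Finset.prod_pow,
      Fintype.card_prod, Fintype.card_fin] at key
    rw [← finprod_max_abv_one_eq_prod fun v ↦ hTt, ← finprod_max_abv_one_eq_prod fun v ↦ hTx] at key
    have h0 (y : L) : 0 ≤ ∏ᶠ v : FunctionFieldPlace L, max (v.abv y) 1 :=
      finprod_nonneg fun v ↦ zero_le_one.trans (h1 v y)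
    have h2 : (Nat.card F : ℝ) ^ ((2 * B + 1) * (2 * A + 1)) ≤
        (Nat.card F : ℝ) ^ (A + (A * (2 * B) + B * (2 * A))) := by
      rw [pow_add, pow_add, pow_mul _ A, pow_mul _ B]
      refine key.trans ?_
      have ht0 := h0 t
      have hx0 := h0 x
      gcongr
      exact_mod_cast hcE.trans (Nat.pow_le_pow_right Nat.card_pos hA)
    rw [pow_le_pow_iff_right₀ hq] at h2
    -- `(2B + 1)(2A + 1) ≤ A + 4AB` is impossible.
    nlinarith
  · rw [map_mul, map_pow, map_pow, hX, hX]
    exact one_le_mul_of_one_le_of_one_le (one_le_pow₀ (h1 _ _)) (one_le_pow₀ (h1 _ _))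
  · rw [map_mul, map_mul, map_pow, map_pow, map_pow, map_pow, hX, hX]
    exact mul_le_mul (hle v t p.1.2) (hle v x p.2.2) (pow_nonneg (v.abv.nonneg _) _)
      (pow_nonneg (zero_le_one.trans (h1 _ _)) _)
  · rw [map_mul, map_pow, map_pow]
    exact mul_le_one₀ (pow_le_one₀ (v.abv.nonneg _) (hTt hv)) (pow_nonneg (v.abv.nonneg _) _)
      (pow_le_one₀ (v.abv.nonneg _) (hTx hv))

omit [Finite F] in
variable {F} in
lemma finite_setOf_relation {Ω : Type*} [Field Ω] [Algebra F Ω] {t : Ω} (ht : Transcendental F t)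
    {m n : ℕ} {P : Fin m × Fin n → F} (hP : P ≠ 0) :
    {x : Ω | ∑ p, P p • (t ^ (p.1 : ℕ) * x ^ (p.2 : ℕ)) = 0}.Finite := by
  let c (j : Fin n) : Polynomial F := ∑ i : Fin m, Polynomial.monomial (i : ℕ) (P (i, j))
  let R : Polynomial Ω := ∑ j : Fin n, Polynomial.monomial (j : ℕ) (Polynomial.aeval t (c j))
  have hR : R ≠ 0 := by
    obtain ⟨⟨i, j⟩, hij⟩ := Function.ne_iff.mp hP
    intro h0
    have h1 := congrArg (Polynomial.coeff · (j : ℕ)) h0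
    simp only [R, Polynomial.finsetSum_coeff, Polynomial.coeff_monomial, Polynomial.coeff_zero,
      Fin.val_inj, Finset.sum_ite_eq', Finset.mem_univ, if_true] at h1
    have h2 := congrArg (Polynomial.coeff · (i : ℕ)) ((transcendental_iff.mp ht) _ h1)
    simp only [c, Polynomial.finsetSum_coeff, Polynomial.coeff_monomial, Polynomial.coeff_zero,
      Fin.val_inj, Finset.sum_ite_eq', Finset.mem_univ, if_true] at h2
    exact hij h2
  refine (Polynomial.finite_setOfPred_isRoot hR).subset fun x hx ↦ ?_
  rw [Set.mem_ofPred_eq] at hx ⊢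
  rw [Polynomial.IsRoot, ← hx, Fintype.sum_prod_type_right]
  simp only [R, c, Polynomial.eval_finsetSum, Polynomial.eval_monomial, map_sum,
    Polynomial.aeval_monomial]
  refine Finset.sum_congr rfl fun j _ ↦ Finset.sum_congr rfl fun i _ ↦ ?_
  rw [Algebra.smul_def, mul_assoc]

include F in
/-- Northcott's theorem for function fields over finite fields. -/
theorem finite_setOf_finrank_le_affineWeilHeight_le_of_functionField (hK : ¬ CharZero K) (D : ℕ)
    (B : ℝ) : {x : AlgebraicClosure K |
      Module.finrank K K⟮x⟯ ≤ D ∧ affineWeilHeight K x ≤ B}.Finite := by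
  obtain ⟨t, ht⟩ := (FunctionField.isFunctionFieldInOneVariable F K).exists_transcendental
  have htΩ : Transcendental F (algebraMap K (AlgebraicClosure K) t) :=
    (transcendental_algebraMap_iff (algebraMap K _).injective).mpr ht
  have hq : 1 < (Nat.card F : ℝ) := by exact_mod_cast Finite.one_lt_card
  obtain ⟨b, hb⟩ := exists_nat_gt (|B| * D / Real.log (Nat.card F))
  rw [div_lt_iff₀ (Real.log_pos hq)] at hb
  let a := Module.finrank F⟮t⟯ K * D
  refine Set.Finite.subset (Set.Finite.biUnion (Set.finite_univ.subset (Set.subset_univ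
    {P : Fin (2 * b + 1) × Fin (2 * a + 1) → F | P ≠ 0}))
    fun P hP ↦ finite_setOf_relation htΩ hP) ?_
  rintro x ⟨hD, hx⟩
  have := adjoin.finiteDimensional (K := K) (Algebra.IsIntegral.isIntegral x)
  have hL := K⟮x⟯.isFunctionFieldInOneVariable F
  obtain ⟨P, hP0, hP⟩ := exists_relation_of_finprod_le hL (t := algebraMap K K⟮x⟯ t)
    (x := AdjoinSimple.gen K x) (A := a) (B := b)
    ((transcendental_algebraMap_iff (algebraMap K _).injective).mpr ht)
    (by rw [finrank_adjoin_simple_algebraMap]; exact Nat.mul_le_mul_left _ hD)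
    (by
      have hpos : 0 < ∏ᶠ v : FunctionFieldPlace K⟮x⟯, max (v.abv (AdjoinSimple.gen K x)) 1 :=
        finprod_induction (0 < ·) zero_lt_one (fun _ _ ↦ mul_pos)
          fun v ↦ zero_lt_one.trans_le (le_max_right _ _)
      have hfr : (0 : ℝ) < Module.finrank K K⟮x⟯ := Nat.cast_pos.mpr Module.finrank_pos
      rw [affineWeilHeight_eq_log_finprod F hK, div_le_iff₀ hfr] at hx
      rw [← Real.log_le_log_iff hpos (by positivity), Real.log_pow]
      calc _ ≤ B * Module.finrank K K⟮x⟯ := hx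
        _ ≤ |B| * D := by gcongr; exact le_abs_self B
        _ ≤ _ := hb.le)
  refine Set.mem_biUnion hP0 ?_
  have h := congrArg (algebraMap K⟮x⟯ (AlgebraicClosure K)) hP
  rw [map_sum, map_zero] at h
  rw [Set.mem_ofPred_eq, ← h]
  refine Finset.sum_congr rfl fun p _ ↦ ?_
  rw [Algebra.smul_def, Algebra.smul_def, map_mul, map_mul, map_pow, map_pow]
  rfl

end FunctionField

/-! ### Global fields -/

open IntermediateField in
lemma finite_setOf_finrank_le_affineWeilHeight_le_of_numberField (K : Type*) [Field K]
    [NumberField K] (D : ℕ) (B : ℝ) :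
    {x : AlgebraicClosure K | Module.finrank K K⟮x⟯ ≤ D ∧ affineWeilHeight K x ≤ B}.Finite := by
  have : CharZero (AlgebraicClosure K) := charZero_of_injective_algebraMap
    (algebraMap K (AlgebraicClosure K)).injective
  have : Algebra.IsAlgebraic ℚ (AlgebraicClosure K) := Algebra.IsAlgebraic.trans ℚ K _
  refine (NumberField.finite_setOf_finrank_le_absLogHeight₁_le (AlgebraicClosure K)
    (Module.finrank ℚ K * D) B).subset fun x hx ↦ ⟨?_, ?_⟩
  · refine le_trans ?_ (Nat.mul_le_mul_left (Module.finrank ℚ K) hx.1)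
    have := adjoin.finiteDimensional (K := K) (Algebra.IsIntegral.isIntegral x)
    have : FiniteDimensional ℚ K⟮x⟯ := Module.Finite.trans K _
    rw [Module.finrank_mul_finrank ℚ K K⟮x⟯]
    have hle : ℚ⟮x⟯ ≤ K⟮x⟯.restrictScalars ℚ :=
      adjoin_simple_le_iff.mpr (mem_adjoin_simple_self K x)
    exact LinearMap.finrank_le_finrank_of_injective
      (f := (inclusion hle).toLinearMap) (inclusion hle).injective
  · have h := hx.2
    rwa [affineWeilHeight, dif_pos (inferInstance : CharZero K)] at h

theorem lemma3p7 {K : Type*} [Field K] (hK : IsGlobalField K)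
    (S : Set (P1Endo K)) (hfin : S.Finite) (hne : S.Nonempty) (hdeg : ∀ φ ∈ S, 2 ≤ φ.deg)
    (D : ℕ) (hD : 0 < D) :
    (∀ (ψ : ℕ → S) (α : P1 K), Filter.Tendsto
      (fun n ↦ (seqAct ψ n α).weilHeight / (seqDeg ψ n : ℝ)) Filter.atTop
      (nhds (canonicalHeight ψ α))) ∧
    0 < sInf {r : ℝ | ∃ (ψ : ℕ → S) (α : P1 K),
      α.degree ≤ D ∧ α ∉ prePer S ∧ r = canonicalHeight ψ α} := by
  rcases hK with hK | ⟨p, hp, hA, hK⟩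
  · have hh : IsAbsoluteWeilHeight (affineWeilHeight K) := by
      have h : affineWeilHeight K = NumberField.absLogHeight₁ := by
        ext x
        rw [affineWeilHeight, dif_pos (inferInstance : CharZero K)]
      rw [h]
      exact NumberField.isAbsoluteWeilHeight_absLogHeight₁ K
    exact canonicalHeight_lower_bound_of_northcott hh
      (finite_setOf_finrank_le_affineWeilHeight_le_of_numberField K) S hfin hne hdeg D hD
  · let _ : Algebra (ZMod p) K :=
      ((algebraMap (RatFunc (ZMod p)) K).comp (algebraMap (ZMod p) (RatFunc (ZMod p)))).toAlgebra
    have : IsScalarTower (ZMod p) (RatFunc (ZMod p)) K := IsScalarTower.of_algebraMap_eq fun _ ↦ rfl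
    have hchar : ¬ CharZero K := by
      intro h0
      have h1 : CharP K p := charP_of_injective_algebraMap (algebraMap (ZMod p) K).injective p
      exact hp.out.ne_zero (CharP.eq K h1 (CharP.ofCharZero K))
    have : Infinite (RatFunc (ZMod p)) :=
      Infinite.of_injective _ (RatFunc.algebraMap_injective (ZMod p))
    have : Infinite K := Infinite.of_injective _ (algebraMap (RatFunc (ZMod p)) K).injective
    exact canonicalHeight_lower_bound_of_northcott
      (isAbsoluteWeilHeight_affineWeilHeight_of_functionField (ZMod p) hchar)
      (finite_setOf_finrank_le_affineWeilHeight_le_of_functionField (ZMod p) hchar)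
      S hfin hne hdeg D hD
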